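/- There is a computable function $n\mapsto A_n\in\mathbf N$ such that the following holds for every integer $n\ge 1$. (i) Let $\Lambda\subset\mathbf R^n$ be a lattice (a discrete subgroup of rank $n$) of covolume $|\Lambda|=\mathrm{Vol}(\mathbf R^n/\Lambda)$, and let $R>0$ be real. If $\Lambda$ has more than $A_nR^n/|\Lambda|$ vectors of Euclidean length $<R$ (the zero vector included), then all these vectors lie in one hyperplane, that is, in a linear subspace of $\mathbf R^n$ of dimension $n-1$. (ii) For this $n$ such a hyperplane can be computed in polynomial time: there are an algorithm and a polynomial $p$, both depending only on $n$, such that, given a nonsingular matrix $B\in\mathbf Q^{n\times n}$ whose entries are written in binary with total bit length $s$, the algorithm halts after at most $p(s)$ bit operations and outputs a nonzero $y\in\mathbf Z^n$ with the following property. Let $\Lambda$ be the lattice spanned over $\mathbf Z$ by the rows of $B$. For every real $R>0$ such that $\Lambda$ has more than $A_nR^n/|\Lambda|$ vectors of length $<R$, all these vectors lie in the hyperplane $\{x\in\mathbf R^n:\sum_i y_ix_i=0\}$. Here an algorithm is a program for a random access machine with integer registers, and its bit operations are counted by logarithmic cost: every instruction is charged the bit lengths of the integers it reads, and a multiplication or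 division the product of the bit lengths of its operands. -/

import Mathlib

/-! ## Lattices, short vectors, hyperplanes -/

/-- The set of vectors of `Λ` of Euclidean length `< R` (the zero vector included). -/
def shortVectors {n : ℕ} (Λ : Submodule ℤ (EuclideanSpace ℝ (Fin n))) (R : ℝ) :
    Set (EuclideanSpace ℝ (Fin n)) :=
  {v | v ∈ Λ ∧ ‖v‖ < R}

/-- The subgroup of `ℝⁿ` generated over `ℤ` by the rows of a rational matrix. When the determinant
is nonzero it is a lattice, with the rows as a basis. -/
def rowLattice {n : ℕ} (B : Matrix (Fin n) (Fin n) ℚ) :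
    Submodule ℤ (EuclideanSpace ℝ (Fin n)) :=
  Submodule.span ℤ (Set.range fun i => WithLp.toLp 2 fun j => (B i j : ℝ))

/-- The subspace of all `x` with `∑ i, y i * x i = 0`; a hyperplane when `y ≠ 0`. -/
noncomputable def normalSubspace {n : ℕ} (y : Fin n → ℤ) :
    Submodule ℝ (EuclideanSpace ℝ (Fin n)) :=
  (Submodule.span ℝ {WithLp.toLp 2 fun i => (y i : ℝ)})ᗮ

/-! ## Random access machines with integer registers and logarithmic (bit) cost -/

namespace BitRAM

/-- Contents of the registers `0, 1, 2, …`. -/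
abbrev Mem : Type := ℕ → ℤ

/-- Programs. Below, `x i` is the content of register `i`. -/
inductive Prog : Type
  /-- `x i := c` -/
  | const (i : ℕ) (c : ℤ)
  /-- `x i := x j + x k` -/
  | add (i j k : ℕ)
  /-- `x i := x j - x k` -/
  | sub (i j k : ℕ)
  /-- `x i := x j * x k` -/
  | mul (i j k : ℕ)
  /-- `x i := x j / x k`, division with remainder (the result is `0` if `x k = 0`) -/
  | div (i j k : ℕ)
  /-- `x i := x |x j|` -/
  | load (i j : ℕ)
  /-- `x |x i| := x j` -/
  | store (i j : ℕ)
  /-- `p` followed by `q` -/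
  | seq (p q : Prog)
  /-- `if 0 < x i then p else q` -/
  | ite (i : ℕ) (p q : Prog)
  /-- `while 0 < x i do p` -/
  | loop (i : ℕ) (p : Prog)

/-- The number of bits of an integer: one for the sign, and the binary digits of `|a|`. -/
def bitLen (a : ℤ) : ℕ := a.natAbs.size + 1

/-- `Exec p m t m'`: program `p`, started with memory `m`, halts with memory `m'`, at total bit
cost `t`. An instruction costs the number of bits of the integers it reads, including those that
serve as addresses; multiplication and division cost the product of the bit lengths of the
operands. -/
inductive Exec : Prog → Mem → ℕ → Mem → Prop
  | const (i : ℕ) (c : ℤ) (m : Mem) :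
      Exec (.const i c) m (bitLen c) (Function.update m i c)
  | add (i j k : ℕ) (m : Mem) :
      Exec (.add i j k) m (bitLen (m j) + bitLen (m k)) (Function.update m i (m j + m k))
  | sub (i j k : ℕ) (m : Mem) :
      Exec (.sub i j k) m (bitLen (m j) + bitLen (m k)) (Function.update m i (m j - m k))
  | mul (i j k : ℕ) (m : Mem) :
      Exec (.mul i j k) m (bitLen (m j) * bitLen (m k)) (Function.update m i (m j * m k))
  | div (i j k : ℕ) (m : Mem) :
      Exec (.div i j k) m (bitLen (m j) * bitLen (m k)) (Function.update m i (m j / m k))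
  | load (i j : ℕ) (m : Mem) :
      Exec (.load i j) m (bitLen (m j) + bitLen (m (m j).natAbs))
        (Function.update m i (m (m j).natAbs))
  | store (i j : ℕ) (m : Mem) :
      Exec (.store i j) m (bitLen (m i) + bitLen (m j))
        (Function.update m (m i).natAbs (m j))
  | seq {p q : Prog} {m m' m'' : Mem} {s t : ℕ} :
      Exec p m s m' → Exec q m' t m'' → Exec (.seq p q) m (s + t) m''
  | ite_true {i : ℕ} {p q : Prog} {m m' : Mem} {t : ℕ} :
      0 < m i → Exec p m t m' → Exec (.ite i p q) m (bitLen (m i) + t) m'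
  | ite_false {i : ℕ} {p q : Prog} {m m' : Mem} {t : ℕ} :
      ¬ 0 < m i → Exec q m t m' → Exec (.ite i p q) m (bitLen (m i) + t) m'
  | loop_stop {i : ℕ} {p : Prog} {m : Mem} :
      ¬ 0 < m i → Exec (.loop i p) m (bitLen (m i)) m
  | loop_step {i : ℕ} {p : Prog} {m m' m'' : Mem} {s t : ℕ} :
      0 < m i → Exec p m s m' → Exec (.loop i p) m' t m'' →
      Exec (.loop i p) m (bitLen (m i) + s + t) m''

/-- The initial memory that presents a rational `n × n` matrix, row by row: with `r = n * i + j`,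
registers `2 * r` and `2 * r + 1` hold the numerator and the denominator of the entry `(i, j)` in
lowest terms; all other registers hold `0`. -/
def inputMem {n : ℕ} (B : Matrix (Fin n) (Fin n) ℚ) : Mem := fun r =>
  if h : r / 2 < n * n then
    let e := finProdFinEquiv.symm ⟨r / 2, h⟩
    if r % 2 = 0 then (B e.1 e.2).num else ((B e.1 e.2).den : ℤ)
  else 0

/-- The bit length of the input `B`. -/
def inputSize {n : ℕ} (B : Matrix (Fin n) (Fin n) ℚ) : ℕ :=
  ∑ i, ∑ j, (bitLen (B i j).num + bitLen (B i j).den)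

/-- The integer vector that a memory holds in its registers `0, …, n - 1`. -/
def outputVec (n : ℕ) (m : Mem) : Fin n → ℤ := fun i => m i

end BitRAM

/-! Both halves rest on one count. Suppose the lattice `Λ` contains vectors of length at most `C *
R` that span the space. Rounding in a basis chosen among them brings any point within `n * C * R` of
`Λ`. Hence every point lies in at least N translates by `Λ` of the ball of radius `(1 + n * C) * R`,
where N is the number of lattice vectors shorter than `R`. Integrating over a fundamental domain
gives N at most `(2 * (1 + n * C)) ^ n * R ^ n / |Λ|` (`ncard_shortVectors_le`). With more short
vectors there is no such spanning set; for the short vectors themselves and `C = 1` this is (i).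

For (ii), the hyperplane is orthogonal to the last Gram–Schmidt vector of an LLL-reduced basis. A
lattice vector `v` off it is at least as long as that Gram–Schmidt vector, which in a reduced basis
dominates all the others up to a constant. Size reduction then yields a basis of vectors of length
at most `n * 2 ^ n * ‖v‖` (`IsBoundedBasis.exists_spanning_set`), and `‖v‖ < R` contradicts the
count with `C = n * 2 ^ n`.

As `n` is fixed, Gram–Schmidt, size reduction and the choice of an exchange unroll into a program
without loops: on entries of β bits its numbers have O(β) bits and its cost is O(β²). An exchange
multiplies the potential by at most 3/4 and does not increase the largest Gram–Schmidt norm, so one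
β serves for the whole run. The potential is a positive fraction whose numerator and denominator
have O(β) bits, so O(β) exchanges suffice and the reduction costs O(β³) (`exists_prog_reduce`). -/

open InnerProductSpace MeasureTheory

/-! ### Bit lengths and straight-line programs -/

namespace BitRAM

lemma one_le_bitLen (a : ℤ) : 1 ≤ bitLen a := Nat.le_add_left 1 _

lemma bitLen_le_succ_iff {a : ℤ} {L : ℕ} : bitLen a ≤ L + 1 ↔ a.natAbs < 2 ^ L := by
  rw [bitLen, Nat.add_le_add_iff_right, Nat.size_le]

lemma natAbs_lt_two_pow_bitLen (a : ℤ) : a.natAbs < 2 ^ bitLen a :=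
  (Nat.lt_size_self _).trans_le (Nat.pow_le_pow_right two_pos (Nat.le_succ _))

lemma bitLen_mono {a b : ℤ} (h : a.natAbs ≤ b.natAbs) : bitLen a ≤ bitLen b :=
  Nat.add_le_add_right (Nat.size_le_size h) 1

lemma bitLen_neg (a : ℤ) : bitLen (-a) = bitLen a := by simp [bitLen]

lemma bitLen_add_le (a b : ℤ) : bitLen (a + b) ≤ bitLen a + bitLen b := by
  have ha := Nat.lt_size_self a.natAbs
  have hb := Nat.lt_size_self b.natAbs
  have : bitLen (a + b) ≤ (a.natAbs.size + b.natAbs.size + 1) + 1 := by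
    rw [bitLen_le_succ_iff]
    have h1 := Nat.pow_le_pow_right two_pos (Nat.le_add_right a.natAbs.size b.natAbs.size)
    have h2 := Nat.pow_le_pow_right two_pos (Nat.le_add_left b.natAbs.size a.natAbs.size)
    rw [pow_succ]
    have := Int.natAbs_add_le a b
    omega
  simp only [bitLen] at this ⊢
  omega

lemma bitLen_sub_le (a b : ℤ) : bitLen (a - b) ≤ bitLen a + bitLen b := by
  rw [sub_eq_add_neg, ← bitLen_neg b]
  exact bitLen_add_le _ _

lemma bitLen_mul_le (a b : ℤ) : bitLen (a * b) ≤ bitLen a + bitLen b := by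
  have : bitLen (a * b) ≤ (a.natAbs.size + b.natAbs.size) + 1 := by
    rw [bitLen_le_succ_iff, Int.natAbs_mul, pow_add]
    exact Nat.mul_lt_mul'' (Nat.lt_size_self _) (Nat.lt_size_self _)
  simp only [bitLen] at this ⊢
  omega

lemma bitLen_ediv_le (a b : ℤ) : bitLen (a / b) ≤ bitLen a :=
  bitLen_mono (Int.natAbs_ediv_le_natAbs a b)

/-- Functions of the registers below `k` that a program without loops can compute into any register
`r ≥ k` without changing the registers below `r`. When the registers below `k` have at most `β`
bits, the value has `O(β)` bits and the cost is `O(β ^ 2)`. -/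
def StraightLine (k : ℕ) (f : Mem → ℤ) : Prop :=
  (∀ m m' : Mem, (∀ i < k, m i = m' i) → f m = f m') ∧
  ∀ r, k ≤ r → ∃ (P : Prog) (K : ℕ), ∀ (m : Mem) (β : ℕ), 1 ≤ β → (∀ i < k, bitLen (m i) ≤ β) →
    bitLen (f m) ≤ K * β ∧ ∃ t m', Exec P m t m' ∧ t ≤ K * β ^ 2 ∧ m' r = f m ∧
      ∀ i < r, m' i = m i

namespace StraightLine

variable {k : ℕ} {f g h : Mem → ℤ}

lemma bitLen_le (hf : StraightLine k f) : ∃ K : ℕ, ∀ (m : Mem) (β : ℕ), 1 ≤ β →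
    (∀ i < k, bitLen (m i) ≤ β) → bitLen (f m) ≤ K * β := by
  obtain ⟨P, K, hP⟩ := hf.2 k le_rfl
  exact ⟨K, fun m β hβ hm => (hP m β hβ hm).1⟩

protected lemma const (k : ℕ) (c : ℤ) : StraightLine k fun _ => c := by
  refine ⟨fun _ _ _ => rfl, fun r _ => ⟨.const r c, bitLen c, fun m β hβ _ => ?_⟩⟩
  refine ⟨Nat.le_mul_of_pos_right _ hβ, _, _, .const r c m,
    Nat.le_mul_of_pos_right _ (pow_pos hβ 2), Function.update_self .., fun i hi => ?_⟩
  exact Function.update_of_ne hi.ne _ _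

protected lemma var {i : ℕ} (hi : i < k) : StraightLine k fun m => m i := by
  -- No instruction copies a register directly, so the content is added to 0.
  refine ⟨fun _ _ hm => hm i hi, fun r hr =>
    ⟨.seq (.const r 0) (.add r r i), 2 * bitLen 0 + 1, fun m β hβ hm => ?_⟩⟩
  refine ⟨(hm i hi).trans (Nat.le_mul_of_pos_left _ (Nat.succ_pos _)), _, _,
    .seq (.const r 0 m) (.add r r i _), ?_, ?_, fun j hj => ?_⟩
  · have h1 := hm i hi
    have h2 : β ≤ β ^ 2 := Nat.le_self_pow two_ne_zero β
    rw [Function.update_self, Function.update_of_ne (by omega)]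
    nlinarith
  · rw [Function.update_self, Function.update_self, Function.update_of_ne (by omega), zero_add]
  · rw [Function.update_of_ne hj.ne, Function.update_of_ne hj.ne]

/-- Closure under an operation that is performed by a single instruction. -/
lemma binop (instr : ℕ → ℕ → ℕ → Prog) (op : ℤ → ℤ → ℤ)
    (hop : ∀ a b, bitLen (op a b) ≤ bitLen a + bitLen b)
    (hinstr : ∀ i j l m, ∃ t, t ≤ (bitLen (m j) + bitLen (m l)) ^ 2 ∧
      Exec (instr i j l) m t (Function.update m i (op (m j) (m l))))
    (hf : StraightLine k f) (hg : StraightLine k g) :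
    StraightLine k fun m => op (f m) (g m) := by
  refine ⟨fun m m' hm => by simp only [hf.1 m m' hm, hg.1 m m' hm], fun r hr => ?_⟩
  obtain ⟨P, K, hP⟩ := hf.2 r hr
  -- The second operand goes to register `r + 1`, so that computing it leaves the first one, in
  -- register `r`, intact.
  obtain ⟨Q, L, hQ⟩ := hg.2 (r + 1) (hr.trans (Nat.le_succ r))
  refine ⟨.seq P (.seq Q (instr r r (r + 1))), K + L + (K + L) ^ 2, fun m β hβ hm => ?_⟩
  obtain ⟨bf, t, m', hE, ht, hr', hlt⟩ := hP m β hβ hm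
  have heq : ∀ i < k, m' i = m i := fun i hi => hlt i (hi.trans_le hr)
  obtain ⟨bg, t', m'', hE', ht', hr'', hlt'⟩ := hQ m' β hβ fun i hi => by
    rw [heq i hi]; exact hm i hi
  rw [hg.1 m' m heq] at bg hr''
  have hfr : m'' r = f m := by rw [hlt' r (Nat.lt_succ_self r), hr']
  obtain ⟨t'', ht'', hE''⟩ := hinstr r r (r + 1) m''
  rw [hfr, hr''] at ht'' hE''
  have hsum : bitLen (f m) + bitLen (g m) ≤ (K + L) * β := by rw [add_mul]; exact add_le_add bf bg
  refine ⟨(hop _ _).trans (hsum.trans (Nat.mul_le_mul_right _ (Nat.le_add_right _ _))), _, _,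
    .seq hE (.seq hE' hE''), ?_, Function.update_self .., fun i hi => ?_⟩
  · have := ht''.trans (Nat.pow_le_pow_left hsum 2)
    rw [mul_pow] at this
    rw [add_mul, add_mul]
    omega
  · rw [Function.update_of_ne hi.ne, hlt' i (hi.trans (Nat.lt_succ_self r)), hlt i hi]

lemma add (hf : StraightLine k f) (hg : StraightLine k g) : StraightLine k fun m => f m + g m :=
  binop .add (· + ·) bitLen_add_le
    (fun i j l m => ⟨_, Nat.le_self_pow two_ne_zero _, .add i j l m⟩) hf hg

lemma sub (hf : StraightLine k f) (hg : StraightLine k g) : StraightLine k fun m => f m - g m :=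
  binop .sub (· - ·) bitLen_sub_le
    (fun i j l m => ⟨_, Nat.le_self_pow two_ne_zero _, .sub i j l m⟩) hf hg

lemma mul (hf : StraightLine k f) (hg : StraightLine k g) : StraightLine k fun m => f m * g m :=
  binop .mul (· * ·) bitLen_mul_le (fun i j l m => ⟨_, by nlinarith, .mul i j l m⟩) hf hg

lemma ediv (hf : StraightLine k f) (hg : StraightLine k g) : StraightLine k fun m => f m / g m :=
  binop .div (· / ·) (fun a b => (bitLen_ediv_le a b).trans (Nat.le_add_right _ _))
    (fun i j l m => ⟨_, by nlinarith, .div i j l m⟩) hf hg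

lemma neg (hf : StraightLine k f) : StraightLine k fun m => -f m := by
  simpa using (StraightLine.const k 0).sub hf

protected lemma ite (hf : StraightLine k f) (hg : StraightLine k g) (hh : StraightLine k h) :
    StraightLine k fun m => if 0 < f m then g m else h m := by
  refine ⟨fun m m' hm => by simp only [hf.1 m m' hm, hg.1 m m' hm, hh.1 m m' hm], fun r hr => ?_⟩
  obtain ⟨P, K, hP⟩ := hf.2 r hr
  obtain ⟨Q, L, hQ⟩ := hg.2 r hr
  obtain ⟨Q', L', hQ'⟩ := hh.2 r hr
  refine ⟨.seq P (.ite r Q Q'), 2 * K + L + L', fun m β hβ hm => ?_⟩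
  obtain ⟨bf, t, m', hE, ht, hr', hlt⟩ := hP m β hβ hm
  have heq : ∀ i < k, m' i = m i := fun i hi => hlt i (hi.trans_le hr)
  have hm' : ∀ i < k, bitLen (m' i) ≤ β := fun i hi => by rw [heq i hi]; exact hm i hi
  have hK : K * β ≤ K * β ^ 2 := Nat.mul_le_mul_left _ (Nat.le_self_pow two_ne_zero β)
  have hβ2 : 0 ≤ L * β ^ 2 ∧ 0 ≤ L' * β ^ 2 ∧ 0 ≤ K * β ∧ 0 ≤ L * β ∧ 0 ≤ L' * β := by simp
  by_cases hpos : 0 < f m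
  · obtain ⟨bg, t', m'', hE', ht', hr'', hlt'⟩ := hQ m' β hβ hm'
    rw [hg.1 m' m heq] at bg hr''
    simp only [if_pos hpos]
    refine ⟨by rw [add_mul, add_mul]; omega, _, _,
      .seq hE (.ite_true (by rwa [hr']) hE'), ?_, hr'', fun i hi => by rw [hlt' i hi, hlt i hi]⟩
    rw [hr', add_mul, add_mul, two_mul, add_mul]
    omega
  · obtain ⟨bg, t', m'', hE', ht', hr'', hlt'⟩ := hQ' m' β hβ hm'
    rw [hh.1 m' m heq] at bg hr''
    simp only [if_neg hpos]
    refine ⟨by rw [add_mul, add_mul]; omega, _, _,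
      .seq hE (.ite_false (by rwa [hr']) hE'), ?_, hr'', fun i hi => by rw [hlt' i hi, hlt i hi]⟩
    rw [hr', add_mul, add_mul, two_mul, add_mul]
    omega

protected lemma prod {ι : Type*} (s : Finset ι) {F : ι → Mem → ℤ}
    (hF : ∀ i ∈ s, StraightLine k (F i)) : StraightLine k fun m => ∏ i ∈ s, F i m := by
  classical
  induction s using Finset.induction_on with
  | empty => simpa using StraightLine.const k 1
  | insert a s ha ih =>
    simp only [Finset.prod_insert ha]
    exact (hF a (Finset.mem_insert_self a s)).mul
      (ih fun i hi => hF i (Finset.mem_insert_of_mem hi))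

end StraightLine

/-! ### Simultaneous assignment and loops -/

/-- Several functions can be computed one after the other into consecutive registers. -/
lemma exists_prog_eval (k r l : ℕ) (hr : k ≤ r) (F : ℕ → Mem → ℤ)
    (hF : ∀ i < l, StraightLine k (F i)) :
    ∃ (P : Prog) (K : ℕ), ∀ (m : Mem) (β : ℕ), 1 ≤ β → (∀ i < k, bitLen (m i) ≤ β) →
      ∃ t m', Exec P m t m' ∧ t ≤ K * β ^ 2 ∧ (∀ i < l, m' (r + i) = F i m) ∧
        ∀ i < r, m' i = m i := by
  induction l with
  | zero =>
    refine ⟨.const r 0, bitLen 0, fun m β hβ _ => ⟨_, _, .const r 0 m,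
      Nat.le_mul_of_pos_right _ (pow_pos hβ 2), fun i hi => absurd hi (Nat.not_lt_zero i),
      fun i hi => Function.update_of_ne hi.ne _ _⟩⟩
  | succ l ih =>
    obtain ⟨P, K, hP⟩ := ih fun i hi => hF i (hi.trans (Nat.lt_succ_self l))
    obtain ⟨Q, L, hQ⟩ := (hF l (Nat.lt_succ_self l)).2 (r + l) (hr.trans (Nat.le_add_right r l))
    refine ⟨.seq P Q, K + L, fun m β hβ hm => ?_⟩
    obtain ⟨t, m', hE, ht, hval, hlt⟩ := hP m β hβ hm
    have heq : ∀ i < k, m' i = m i := fun i hi => hlt i (hi.trans_le hr)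
    obtain ⟨-, t', m'', hE', ht', hval', hlt'⟩ := hQ m' β hβ fun i hi => by
      rw [heq i hi]; exact hm i hi
    refine ⟨_, _, .seq hE hE', by rw [add_mul]; omega, fun i hi => ?_, fun i hi => ?_⟩
    · rcases Nat.lt_succ_iff_lt_or_eq.1 hi with hi | rfl
      · rw [hlt' _ (by omega), hval i hi]
      · rw [hval', (hF i (Nat.lt_succ_self i)).1 m' m heq]
    · rw [hlt' i (by omega), hlt i hi]

/-- A block of registers can be moved down. -/
lemma exists_prog_copy (r L l : ℕ) (hL : L ≤ r) (hl : l ≤ L) :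
    ∃ P : Prog, ∀ (m : Mem) (β : ℕ), (∀ i < l, bitLen (m (r + i)) ≤ β) →
      ∃ t m', Exec P m t m' ∧ t ≤ (l + 1) * (2 * bitLen 0 + β) ∧ (∀ i < l, m' i = m (r + i)) ∧
        ∀ i, l ≤ i → i < r + L → m' i = m i := by
  induction l with
  | zero =>
    -- There is no empty program; this instruction writes just above the registers declared
    -- unchanged.
    refine ⟨.const (r + L) 0, fun m β _ => ⟨_, _, .const (r + L) 0 m, by omega,
      fun i hi => absurd hi (Nat.not_lt_zero i), fun i _ hi => Function.update_of_ne hi.ne _ _⟩⟩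
  | succ l ih =>
    obtain ⟨P, hP⟩ := ih (by omega)
    refine ⟨.seq P (.seq (.const l 0) (.add l l (r + l))), fun m β hm => ?_⟩
    have hne : r + l ≠ l := by omega
    obtain ⟨t, m', hE, ht, hval, hrest⟩ := hP m β fun i hi => hm i (by omega)
    refine ⟨_, _, .seq hE (.seq (.const l 0 m') (.add l l (r + l) _)), ?_, fun i hi => ?_,
      fun i hi hi' => ?_⟩
    · have := hm l (Nat.lt_succ_self l)
      rw [Function.update_self, Function.update_of_ne hne, hrest _ (by omega) (by omega)]
      nlinarith
    · rcases Nat.lt_succ_iff_lt_or_eq.1 hi with hi | rfl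
      · rw [Function.update_of_ne hi.ne, Function.update_of_ne hi.ne, hval i hi]
      · rw [Function.update_self, Function.update_self, Function.update_of_ne hne, zero_add,
          hrest _ (by omega) (by omega)]
    · rw [Function.update_of_ne (by omega), Function.update_of_ne (by omega),
        hrest i (by omega) hi']

/-- Simultaneous assignment: the first `l` registers can be replaced by the values of `l`
straight-line functions of the old memory, at quadratic cost. -/
lemma exists_prog_assign (k l : ℕ) (F : ℕ → Mem → ℤ) (hF : ∀ i < l, StraightLine k (F i)) :
    ∃ (P : Prog) (K : ℕ), ∀ (m : Mem) (β : ℕ), 1 ≤ β → (∀ i < k, bitLen (m i) ≤ β) →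
      ∃ t m', Exec P m t m' ∧ t ≤ K * β ^ 2 ∧
        ∀ i < l, m' i = F i m ∧ bitLen (m' i) ≤ K * β := by
  -- The values are first written from register `k + l` on: all are computed from the old memory,
  -- and copying them down overwrites none of them.
  obtain ⟨P, K, hP⟩ := exists_prog_eval k (k + l) l (Nat.le_add_right k l) F hF
  obtain ⟨Q, hQ⟩ := exists_prog_copy (k + l) l l (Nat.le_add_left l k) le_rfl
  have hb : ∀ i : ℕ, ∃ L : ℕ, i < l → ∀ (m : Mem) (β : ℕ), 1 ≤ β →
      (∀ i < k, bitLen (m i) ≤ β) → bitLen (F i m) ≤ L * β := fun i => by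
    by_cases hi : i < l
    · obtain ⟨L, hL⟩ := (hF i hi).bitLen_le
      exact ⟨L, fun _ => hL⟩
    · exact ⟨0, fun h => absurd h hi⟩
  choose L hL using hb
  set M := ∑ i ∈ Finset.range l, L i with hM
  have hM' : ∀ i < l, ∀ (m : Mem) (β : ℕ), 1 ≤ β → (∀ i < k, bitLen (m i) ≤ β) →
      bitLen (F i m) ≤ M * β := fun i hi m β hβ hm =>
    (hL i hi m β hβ hm).trans (Nat.mul_le_mul_right _
      (Finset.single_le_sum (fun _ _ => Nat.zero_le _) (Finset.mem_range.2 hi)))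
  refine ⟨.seq P Q, K + (l + 1) * (2 * bitLen 0 + M), fun m β hβ hm => ?_⟩
  obtain ⟨t, m', hE, ht, hval, -⟩ := hP m β hβ hm
  obtain ⟨t', m'', hE', ht', hval', -⟩ := hQ m' (M * β) fun i hi => by
    rw [hval i hi]
    exact hM' i hi m β hβ hm
  refine ⟨_, _, .seq hE hE', ?_, fun i hi => ?_⟩
  swap
  · rw [hval' i hi, hval i hi]
    exact ⟨rfl, (hM' i hi m β hβ hm).trans (Nat.mul_le_mul_right _ (by nlinarith))⟩
  have h1 : 1 ≤ β ^ 2 := Nat.one_le_pow _ _ hβ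
  have h2 : β ≤ β ^ 2 := Nat.le_self_pow two_ne_zero β
  have h3 : (l + 1) * (2 * bitLen 0 + M * β) ≤ (l + 1) * (2 * bitLen 0 * β ^ 2 + M * β ^ 2) :=
    Nat.mul_le_mul_left _ (add_le_add (Nat.le_mul_of_pos_right _ h1) (Nat.mul_le_mul_left _ h2))
  calc t + t' ≤ K * β ^ 2 + (l + 1) * (2 * bitLen 0 * β ^ 2 + M * β ^ 2) :=
        add_le_add ht (ht'.trans h3)
    _ = _ := by ring

/-- Total correctness of a loop, with an invariant that carries a bound on the number of
iterations. -/
lemma exec_loop {i T : ℕ} {P : Prog} (I : ℕ → Mem → Prop)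
    (hT : ∀ N m, I N m → bitLen (m i) ≤ T) (hzero : ∀ m, I 0 m → ¬ 0 < m i)
    (hstep : ∀ N m, I (N + 1) m → 0 < m i → ∃ t m', Exec P m t m' ∧ t ≤ T ∧ I N m') (N : ℕ) :
    ∀ m, I N m → ∃ t m', Exec (.loop i P) m t m' ∧ t ≤ (N + 1) * (2 * T) ∧ ¬ 0 < m' i ∧
      ∃ N', I N' m' := by
  induction N with
  | zero =>
    exact fun m hm => ⟨_, m, Exec.loop_stop (hzero m hm), by have := hT _ m hm; omega, hzero m hm,
      0, hm⟩
  | succ N ih =>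
    intro m hm
    have hb := hT _ m hm
    by_cases hpos : 0 < m i
    · obtain ⟨t, m', hE, ht, hm'⟩ := hstep N m hm hpos
      obtain ⟨t', m'', hE', ht', hfinal, hI⟩ := ih m' hm'
      exact ⟨_, m'', .loop_step hpos hE hE', by nlinarith, hfinal, hI⟩
    · exact ⟨_, m, Exec.loop_stop hpos, by nlinarith, hpos, N + 1, hm⟩

/-! ### Fractions of straight-line functions -/

/-- Real functions of the registers below `k` that are fractions of two straight-line functions,
with a positive denominator. -/
def StraightLineFrac (k : ℕ) (f : Mem → ℝ) : Prop :=
  ∃ a d : Mem → ℤ, StraightLine k a ∧ StraightLine k d ∧ (∀ m, 0 < d m) ∧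
    ∀ m, f m = (a m : ℝ) / (d m : ℝ)

lemma StraightLine.frac {k : ℕ} {f : Mem → ℤ} (hf : StraightLine k f) :
    StraightLineFrac k fun m => (f m : ℝ) :=
  ⟨f, fun _ => 1, hf, .const k 1, fun _ => one_pos, fun m => by simp⟩

namespace StraightLineFrac

variable {k : ℕ} {f g : Mem → ℝ}

lemma add (hf : StraightLineFrac k f) (hg : StraightLineFrac k g) :
    StraightLineFrac k fun m => f m + g m := by
  obtain ⟨a, d, ha, hd, hd0, hf⟩ := hf
  obtain ⟨b, e, hb, he, he0, hg⟩ := hg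
  refine ⟨_, _, (ha.mul he).add (hd.mul hb), hd.mul he, fun m => mul_pos (hd0 m) (he0 m),
    fun m => ?_⟩
  have h1 : (d m : ℝ) ≠ 0 := Int.cast_ne_zero.2 (hd0 m).ne'
  have h2 : (e m : ℝ) ≠ 0 := Int.cast_ne_zero.2 (he0 m).ne'
  simp only [hf, hg, Int.cast_add, Int.cast_mul]
  rw [div_add_div _ _ h1 h2]

lemma mul (hf : StraightLineFrac k f) (hg : StraightLineFrac k g) :
    StraightLineFrac k fun m => f m * g m := by
  obtain ⟨a, d, ha, hd, hd0, hf⟩ := hf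
  obtain ⟨b, e, hb, he, he0, hg⟩ := hg
  refine ⟨_, _, ha.mul hb, hd.mul he, fun m => mul_pos (hd0 m) (he0 m), fun m => ?_⟩
  simp only [hf, hg, Int.cast_mul]
  rw [div_mul_div_comm]

lemma neg (hf : StraightLineFrac k f) : StraightLineFrac k fun m => -f m := by
  obtain ⟨a, d, ha, hd, hd0, hf⟩ := hf
  exact ⟨_, d, ha.neg, hd, hd0, fun m => by simp only [hf, Int.cast_neg, neg_div]⟩

lemma sub (hf : StraightLineFrac k f) (hg : StraightLineFrac k g) :
    StraightLineFrac k fun m => f m - g m := by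
  simpa only [sub_eq_add_neg] using hf.add hg.neg

/-- The sign of the numerator is tested to keep the new denominator positive; a zero numerator gives
`0 / 1`, in agreement with `0⁻¹ = 0`. -/
lemma inv (hf : StraightLineFrac k f) : StraightLineFrac k fun m => (f m)⁻¹ := by
  obtain ⟨a, d, ha, hd, hd0, hf⟩ := hf
  refine ⟨_, _, ha.ite hd (ha.neg.ite hd.neg (.const k 0)),
    ha.ite ha (ha.neg.ite ha.neg (.const k 1)), fun m => ?_, fun m => ?_⟩
  · split_ifs <;> omega
  · simp only [hf, inv_div]
    split_ifs with h1 h2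
    · rfl
    · rw [Int.cast_neg, Int.cast_neg, neg_div_neg_eq]
    · have : a m = 0 := by omega
      simp [this]

lemma div (hf : StraightLineFrac k f) (hg : StraightLineFrac k g) :
    StraightLineFrac k fun m => f m / g m := by
  simpa only [div_eq_mul_inv] using hf.mul hg.inv

protected lemma sum {ι : Type*} (s : Finset ι) {F : ι → Mem → ℝ}
    (hF : ∀ i ∈ s, StraightLineFrac k (F i)) : StraightLineFrac k fun m => ∑ i ∈ s, F i m := by
  classical
  induction s using Finset.induction_on with
  | empty => simpa using (StraightLine.const k 0).frac
  | insert a s ha ih =>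
    simp only [Finset.sum_insert ha]
    exact (hF a (Finset.mem_insert_self a s)).add
      (ih fun i hi => hF i (Finset.mem_insert_of_mem hi))

protected lemma prod {ι : Type*} (s : Finset ι) {F : ι → Mem → ℝ}
    (hF : ∀ i ∈ s, StraightLineFrac k (F i)) : StraightLineFrac k fun m => ∏ i ∈ s, F i m := by
  classical
  induction s using Finset.induction_on with
  | empty => simpa using (StraightLine.const k 1).frac
  | insert a s ha ih =>
    simp only [Finset.prod_insert ha]
    exact (hF a (Finset.mem_insert_self a s)).mul
      (ih fun i hi => hF i (Finset.mem_insert_of_mem hi))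

/-- The nearest integer to a fraction. -/
lemma straightLine_round (hf : StraightLineFrac k f) : StraightLine k fun m => round (f m) := by
  obtain ⟨a, d, ha, hd, hd0, hf⟩ := hf
  -- Rounding is the floor of `a / d + 1 / 2`, and integer division by a positive number is a floor.
  have key : ∀ m, round (f m) = (2 * a m + d m) / (2 * d m) := fun m => by
    obtain ⟨e, he⟩ : ∃ e : ℕ, 2 * d m = e := Int.eq_ofNat_of_zero_le (by have := hd0 m; omega)
    have h1 : (d m : ℝ) ≠ 0 := Int.cast_ne_zero.2 (hd0 m).ne'
    have h2 : (2 : ℝ) * d m = e := by exact_mod_cast he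
    rw [he, ← Int.floor_intCast (R := ℝ) (2 * a m + d m), ← Int.floor_div_natCast, round_eq, hf,
      ← h2]
    congr 1
    push_cast
    field_simp
  simp only [key]
  exact (((StraightLine.const k 2).mul ha).add hd).ediv ((StraightLine.const k 2).mul hd)

/-- The choice between two values according to the sign of a fraction. -/
lemma straightLine_ite (hf : StraightLineFrac k f) {g h : Mem → ℤ} (hg : StraightLine k g)
    (hh : StraightLine k h) : StraightLine k fun m => if 0 < f m then g m else h m := by
  obtain ⟨a, d, ha, hd, hd0, hf⟩ := hf
  have key : ∀ m, 0 < f m ↔ 0 < a m := fun m => by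
    rw [hf, div_pos_iff_of_pos_right (Int.cast_pos.2 (hd0 m)), Int.cast_pos]
  simp only [key]
  exact ha.ite hg hh

/-- Positive values are neither too large nor too small. -/
lemma pos_bounds (hf : StraightLineFrac k f) : ∃ K : ℕ, ∀ (m : Mem) (β : ℕ), 1 ≤ β →
    (∀ i < k, bitLen (m i) ≤ β) → 0 < f m → f m ≤ 2 ^ (K * β) ∧ 1 ≤ 2 ^ (K * β) * f m := by
  obtain ⟨a, d, ha, hd, hd0, hf⟩ := hf
  -- A positive value is a quotient of two positive integers with O(β) bits, each at least 1.
  obtain ⟨K, hK⟩ := ha.bitLen_le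
  obtain ⟨L, hL⟩ := hd.bitLen_le
  have cast_le : ∀ (z : ℤ) (M β : ℕ), bitLen z ≤ M * β → M ≤ K + L →
      (z : ℝ) ≤ 2 ^ ((K + L) * β) := fun z M β hz hM => by
    have h1 : (z.natAbs : ℝ) ≤ 2 ^ bitLen z := by exact_mod_cast (natAbs_lt_two_pow_bitLen z).le
    have h2 : (z : ℝ) ≤ z.natAbs := by rw [Nat.cast_natAbs]; exact_mod_cast le_abs_self z
    exact (h2.trans h1).trans
      (pow_le_pow_right₀ one_le_two (hz.trans (Nat.mul_le_mul_right _ hM)))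
  refine ⟨K + L, fun m β hβ hm hpos => ?_⟩
  have hdpos : (0 : ℝ) < d m := Int.cast_pos.2 (hd0 m)
  have h1d : (1 : ℝ) ≤ d m := by exact_mod_cast hd0 m
  have hd' := cast_le _ L β (hL m β hβ hm) (Nat.le_add_left _ _)
  have ha' := cast_le _ K β (hK m β hβ hm) (Nat.le_add_right _ _)
  rw [hf] at hpos ⊢
  have hapos : 0 < a m := by rwa [div_pos_iff_of_pos_right hdpos, Int.cast_pos] at hpos
  have h1a : (1 : ℝ) ≤ a m := by exact_mod_cast hapos
  constructor
  · exact (div_le_self (zero_le_one.trans h1a) h1d).trans ha'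
  · rw [← mul_div_assoc, one_le_div hdpos]
    exact hd'.trans (le_mul_of_one_le_right (by positivity) h1a)

end StraightLineFrac

end BitRAM

/-! ### Counting short lattice vectors -/

/-- A set of vectors of length at most `ρ` in a lattice, if it spans the space, makes every point
of the space lie within `n * ρ` of the lattice. -/
lemma exists_lattice_dist_le {n : ℕ} (Λ : Submodule ℤ (EuclideanSpace ℝ (Fin n)))
    {S : Set (EuclideanSpace ℝ (Fin n))} {ρ : ℝ} (hS : S ⊆ Λ)
    (hspan : Submodule.span ℝ S = ⊤) (hρ : ∀ v ∈ S, ‖v‖ ≤ ρ) (x : EuclideanSpace ℝ (Fin n)) :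
    ∃ v ∈ Λ, ‖x + v‖ ≤ n * ρ := by
  let b := Module.Basis.ofSpan hspan.ge
  have hb : ∀ i, b i ∈ S := fun i => Module.Basis.ofSpan_subset hspan.ge ⟨i, rfl⟩
  have : Fintype _ := FiniteDimensional.fintypeBasisIndex b
  -- What remains of `x` has coordinates in `[0, 1)` in the basis `b`, which has `n` vectors of
  -- length at most `ρ`.
  refine ⟨-(ZSpan.floor b x : EuclideanSpace ℝ (Fin n)), Λ.neg_mem ?_, ?_⟩
  · refine Submodule.span_le.2 ?_ (ZSpan.floor b x).2
    rintro _ ⟨i, rfl⟩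
    exact hS (hb i)
  · rw [← sub_eq_add_neg, ← ZSpan.fract_apply]
    refine (ZSpan.norm_fract_le b x).trans ?_
    refine (Finset.sum_le_card_nsmul _ _ ρ fun i _ => hρ _ (hb i)).trans ?_
    rw [Finset.card_univ, ← Module.finrank_eq_card_basis b, finrank_euclideanSpace_fin,
      nsmul_eq_mul]

/-- The ball lies in a cube of side `2 * r`; this crude bound makes the final constant an explicit
integer. -/
lemma volume_real_ball_le {n : ℕ} {r : ℝ} (hr : 0 ≤ r) :
    volume.real (Metric.ball (0 : EuclideanSpace ℝ (Fin n)) r) ≤ (2 * r) ^ n := by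
  have hsub : Metric.ball (0 : EuclideanSpace ℝ (Fin n)) r ⊆
      WithLp.ofLp ⁻¹' Set.univ.pi fun _ : Fin n => Set.Icc (-r) r := by
    intro v hv i _
    rw [mem_ball_zero_iff] at hv
    exact abs_le.1 ((PiLp.norm_apply_le v i).trans hv.le)
  have hvol : volume (WithLp.ofLp ⁻¹' Set.univ.pi fun _ : Fin n => Set.Icc (-r) r :
      Set (EuclideanSpace ℝ (Fin n))) = ENNReal.ofReal ((2 * r) ^ n) := by
    rw [(PiLp.volume_preserving_ofLp (Fin n)).measure_preimage
      (MeasurableSet.univ_pi fun _ => measurableSet_Icc).nullMeasurableSet, volume_pi_pi]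
    simp only [Real.volume_Icc, Finset.prod_const, Finset.card_univ, Fintype.card_fin]
    rw [← ENNReal.ofReal_pow (by linarith)]
    ring_nf
  have := measure_mono (μ := volume) hsub
  rw [hvol] at this
  exact ENNReal.toReal_le_of_le_ofReal (by positivity) this

/-- A lattice that comes within `ρ` of every point has few short vectors. -/
lemma ncard_shortVectors_mul_covolume_le {n : ℕ} (Λ : Submodule ℤ (EuclideanSpace ℝ (Fin n)))
    [DiscreteTopology Λ] [IsZLattice ℝ Λ] {R ρ : ℝ} (hR : 0 < R) (hρ : 0 ≤ ρ)
    (hcov : ∀ x : EuclideanSpace ℝ (Fin n), ∃ v ∈ Λ, ‖x + v‖ ≤ ρ) :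
    ((shortVectors Λ R).ncard : ℝ) * ZLattice.covolume Λ ≤ (2 * (R + ρ)) ^ n := by
  refine le_trans ?_ (volume_real_ball_le (by positivity))
  -- For an infinite set `ncard` is 0 and the bound is trivial.
  by_cases hfin : (shortVectors Λ R).Finite
  swap
  · rw [Set.Infinite.ncard hfin]
    simp
  classical
  set ball := Metric.ball (0 : EuclideanSpace ℝ (Fin n)) (R + ρ) with hball
  let bZ := Module.Free.chooseBasis ℤ Λ
  set F := ZSpan.fundamentalDomain (Module.Basis.ofZLatticeBasis ℝ Λ bZ) with hF
  have hfund : IsAddFundamentalDomain Λ F volume := ZLattice.isAddFundamentalDomain bZ volume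
  rw [ZLattice.covolume_eq_measure_fundamentalDomain Λ volume hfund]
  have : VAddInvariantMeasure Λ (EuclideanSpace ℝ (Fin n)) volume :=
    inferInstanceAs (VAddInvariantMeasure Λ.toAddSubgroup (EuclideanSpace ℝ (Fin n)) volume)
  -- The volume of the ball is the integral over `F` of the number of lattice translates of `x` that
  -- fall into the ball.
  have hunfold := hfund.lintegral_eq_tsum'' (ball.indicator 1)
  rw [lintegral_indicator_one Metric.isOpen_ball.measurableSet,
    ← lintegral_tsum] at hunfold
  swap
  · exact fun g => ((measurable_one.indicator Metric.isOpen_ball.measurableSet).comp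
      (measurable_const_add (g : EuclideanSpace ℝ (Fin n)))).aemeasurable
  -- Once `v` brings `x` within `ρ` of the origin, each short `u` contributes the translate by `u +
  -- v`.
  have hcount : ∀ x, ((shortVectors Λ R).ncard : ENNReal) ≤
      ∑' g : Λ, ball.indicator (1 : EuclideanSpace ℝ (Fin n) → ENNReal) (g +ᵥ x) := fun x => by
    obtain ⟨v, hv, hxv⟩ := hcov x
    let s : Finset Λ := hfin.toFinset.attach.image fun u : hfin.toFinset =>
      ⟨u.1 + v, Λ.add_mem ((hfin.mem_toFinset.1 u.2).1) hv⟩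
    have hs : s.card = (shortVectors Λ R).ncard := by
      rw [Finset.card_image_of_injective, Finset.card_attach, Set.ncard_eq_toFinset_card _ hfin]
      intro u w huw
      exact Subtype.ext (add_right_cancel (congrArg Subtype.val huw))
    refine le_trans (le_of_eq ?_) (ENNReal.sum_le_tsum s)
    rw [Finset.sum_congr rfl (g := fun _ => (1 : ENNReal)), Finset.sum_const, hs, nsmul_one]
    intro g hg
    obtain ⟨u, -, rfl⟩ := Finset.mem_image.1 hg
    rw [Set.indicator_of_mem, Pi.one_apply]
    have hu := (hfin.mem_toFinset.1 u.2).2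
    rw [hball, mem_ball_zero_iff, Submodule.vadd_def, vadd_eq_add]
    calc ‖(u : EuclideanSpace ℝ (Fin n)) + v + x‖ = ‖(u : EuclideanSpace ℝ (Fin n)) + (x + v)‖ := by
          congr 1; abel
      _ ≤ ‖(u : EuclideanSpace ℝ (Fin n))‖ + ‖x + v‖ := norm_add_le _ _
      _ < R + ρ := add_lt_add_of_lt_of_le hu hxv
  have hle : ((shortVectors Λ R).ncard : ENNReal) * volume F ≤ volume ball := by
    rw [hunfold, ← setLIntegral_const]
    exact lintegral_mono hcount
  have := ENNReal.toReal_mono measure_ball_lt_top.ne hle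
  simpa [Measure.real] using this

/-- If the short vectors span the space up to a constant factor `C`, they are few. -/
lemma ncard_shortVectors_le {n : ℕ} (Λ : Submodule ℤ (EuclideanSpace ℝ (Fin n)))
    [DiscreteTopology Λ] [IsZLattice ℝ Λ] {R C : ℝ} (hR : 0 < R) (hC : 0 ≤ C)
    {S : Set (EuclideanSpace ℝ (Fin n))} (hS : S ⊆ Λ) (hspan : Submodule.span ℝ S = ⊤)
    (hSR : ∀ v ∈ S, ‖v‖ ≤ C * R) :
    ((shortVectors Λ R).ncard : ℝ) ≤
      (2 * (1 + n * C)) ^ n * R ^ n / ZLattice.covolume Λ := by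
  rw [le_div_iff₀ (ZLattice.covolume_pos Λ volume), ← mul_pow]
  convert ncard_shortVectors_mul_covolume_le Λ hR (ρ := n * (C * R)) (by positivity)
    (exists_lattice_dist_le Λ hS hspan hSR) using 1
  congr 1
  ring

lemma exists_hyperplane_of_span_ne_top {n : ℕ} {S : Set (EuclideanSpace ℝ (Fin n))}
    (hS : Submodule.span ℝ S ≠ ⊤) :
    ∃ H : Submodule ℝ (EuclideanSpace ℝ (Fin n)), Module.finrank ℝ H + 1 = n ∧ S ⊆ H := by
  obtain ⟨f, hf, hle⟩ := Submodule.exists_le_ker_of_lt_top _ hS.lt_top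
  refine ⟨f.ker, ?_, Submodule.span_le.1 hle⟩
  rw [Module.Dual.finrank_ker_add_one_of_ne_zero hf, finrank_euclideanSpace_fin]

/-! ### Gram–Schmidt vectors under size reduction and exchange -/

section GramSchmidt

variable {E : Type*} [NormedAddCommGroup E] [InnerProductSpace ℝ E] {b b' : ℕ → E} {i k n : ℕ}

lemma inner_gramSchmidt_of_mem_span {u : E} (hu : u ∈ Submodule.span ℝ (b '' Set.Iio i)) :
    inner ℝ (gramSchmidt ℝ b i) u = 0 := by
  induction hu using Submodule.span_induction with
  | mem x hx =>
    obtain ⟨j, hj, rfl⟩ := hx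
    exact gramSchmidt_inv_triangular ℝ b hj
  | zero => exact inner_zero_right _
  | add x y _ _ hx hy => rw [inner_add_right, hx, hy, add_zero]
  | smul a x _ hx => rw [inner_smul_right, hx, mul_zero]

lemma sum_smul_gramSchmidt_mem_span (b : ℕ → E) (a : ℕ → ℝ) (i : ℕ) :
    ∑ j ∈ Finset.range i, a j • gramSchmidt ℝ b j ∈ Submodule.span ℝ (b '' Set.Iio i) := by
  rw [← span_gramSchmidt_Iio]
  exact Submodule.sum_mem _ fun j hj => Submodule.smul_mem _ _
    (Submodule.subset_span ⟨j, Finset.mem_range.1 hj, rfl⟩)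

lemma eq_gramSchmidt_add_sum (b : ℕ → E) (i : ℕ) :
    b i = gramSchmidt ℝ b i + ∑ j ∈ Finset.range i,
      (inner ℝ (gramSchmidt ℝ b j) (b i) / ‖gramSchmidt ℝ b j‖ ^ 2) • gramSchmidt ℝ b j := by
  have := gramSchmidt_def'' ℝ b i
  rwa [Nat.Iio_eq_range] at this

lemma sub_gramSchmidt_mem_span (b : ℕ → E) (i : ℕ) :
    b i - gramSchmidt ℝ b i ∈ Submodule.span ℝ (b '' Set.Iio i) := by
  conv in b i => rw [eq_gramSchmidt_add_sum b i]
  rw [add_sub_cancel_left]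
  exact sum_smul_gramSchmidt_mem_span b _ i

lemma inner_gramSchmidt_self (b : ℕ → E) (i : ℕ) :
    inner ℝ (gramSchmidt ℝ b i) (b i) = ‖gramSchmidt ℝ b i‖ ^ 2 := by
  have := inner_gramSchmidt_of_mem_span (sub_gramSchmidt_mem_span b i)
  rw [inner_sub_right, real_inner_self_eq_norm_sq] at this
  linarith

/-- The characteristic property of the Gram–Schmidt vectors. -/
lemma eq_gramSchmidt_of_orthogonal {u : E} (hu : u - b i ∈ Submodule.span ℝ (b '' Set.Iio i))
    (ho : ∀ j < i, inner ℝ u (b j) = 0) : gramSchmidt ℝ b i = u := by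
  -- The difference lies in the span of the earlier vectors and is orthogonal to that span, hence is
  -- zero.
  have hmem : gramSchmidt ℝ b i - u ∈ Submodule.span ℝ (b '' Set.Iio i) := by
    have := Submodule.add_mem _ (sub_gramSchmidt_mem_span b i) hu
    rw [← Submodule.neg_mem_iff]
    convert this using 1
    abel
  have hu0 : ∀ x ∈ Submodule.span ℝ (b '' Set.Iio i), inner ℝ u x = 0 := fun x hx => by
    induction hx using Submodule.span_induction with
    | mem x hx =>
      obtain ⟨j, hj, rfl⟩ := hx
      exact ho j hj
    | zero => exact inner_zero_right _
    | add x y _ _ hx hy => rw [inner_add_right, hx, hy, add_zero]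
    | smul a x _ hx => rw [inner_smul_right, hx, mul_zero]
  rw [← sub_eq_zero, ← inner_self_eq_zero (𝕜 := ℝ), inner_sub_left,
    inner_gramSchmidt_of_mem_span hmem, hu0 _ hmem, sub_zero]

/-- The Gram–Schmidt vectors do not change when combinations of earlier vectors are added. -/
lemma gramSchmidt_eq_of_sub_mem_span
    (h : ∀ i < n, b' i - b i ∈ Submodule.span ℝ (b '' Set.Iio i)) :
    ∀ i < n, gramSchmidt ℝ b' i = gramSchmidt ℝ b i := by
  intro i
  induction i using Nat.strong_induction_on with
  | _ i ih =>
    intro hi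
    have hspan : Submodule.span ℝ (b' '' Set.Iio i) = Submodule.span ℝ (b '' Set.Iio i) := by
      rw [← span_gramSchmidt_Iio ℝ b', ← span_gramSchmidt_Iio ℝ b]
      congr 1
      exact Set.image_congr fun j hj => ih j hj (lt_trans hj hi)
    refine eq_gramSchmidt_of_orthogonal ?_ fun j hj => ?_
    · rw [hspan]
      have := Submodule.add_mem _ (h i hi) (sub_gramSchmidt_mem_span b i)
      rw [← Submodule.neg_mem_iff]
      convert this using 1
      abel
    · refine inner_gramSchmidt_of_mem_span ?_
      rw [← hspan]
      exact Submodule.subset_span ⟨j, hj, rfl⟩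

/-- In a size-reduced vector the Gram–Schmidt coefficients are at most 1/2 in absolute value; only
the bound 1 is used. This is what keeps the entries from growing. -/
lemma norm_le_sum_norm_gramSchmidt
    (h : ∀ i < n, b' i - b i ∈ Submodule.span ℝ (b '' Set.Iio i))
    (hred : ∀ i < n, ∀ j < i, |inner ℝ (gramSchmidt ℝ b j) (b' i)| ≤
      ‖gramSchmidt ℝ b j‖ ^ 2 / 2) (hi : i < n) :
    ‖b' i‖ ≤ ∑ j ∈ Finset.range (i + 1), ‖gramSchmidt ℝ b j‖ := by
  have hgs := gramSchmidt_eq_of_sub_mem_span h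
  rw [eq_gramSchmidt_add_sum b' i, Finset.sum_range_succ, add_comm, hgs i hi]
  refine (norm_add_le _ _).trans (add_le_add_left ((norm_sum_le _ _).trans ?_) _)
  refine Finset.sum_le_sum fun j hj => ?_
  have hj' := Finset.mem_range.1 hj
  rw [hgs j (hj'.trans hi), norm_smul, Real.norm_eq_abs, abs_div, abs_of_nonneg (sq_nonneg ‖_‖)]
  refine mul_le_of_le_one_left (norm_nonneg _) (div_le_one_of_le₀ ?_ (sq_nonneg _))
  exact (hred i hi j hj').trans (half_le_self (sq_nonneg _))

/-- The effect on the Gram–Schmidt vectors of an exchange of two neighbours. -/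
lemma gramSchmidt_swap (hkn : k + 1 < n) (hne : gramSchmidt ℝ b (k + 1) ≠ 0)
    (h : ∀ i < n, b' i = b (Equiv.swap k (k + 1) i)) :
    (∀ i < n, i ≠ k → i ≠ k + 1 → gramSchmidt ℝ b' i = gramSchmidt ℝ b i) ∧
    ‖gramSchmidt ℝ b' k‖ ^ 2 = ‖gramSchmidt ℝ b (k + 1)‖ ^ 2 +
      (inner ℝ (gramSchmidt ℝ b k) (b (k + 1)) / ‖gramSchmidt ℝ b k‖ ^ 2) ^ 2 *
        ‖gramSchmidt ℝ b k‖ ^ 2 ∧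
    ‖gramSchmidt ℝ b' k‖ ^ 2 * ‖gramSchmidt ℝ b' (k + 1)‖ ^ 2 =
      ‖gramSchmidt ℝ b k‖ ^ 2 * ‖gramSchmidt ℝ b (k + 1)‖ ^ 2 := by
  have hk' : b' k = b (k + 1) := by rw [h k (by omega), Equiv.swap_apply_left]
  have hk1' : b' (k + 1) = b k := by rw [h _ hkn, Equiv.swap_apply_right]
  have hother : ∀ i < n, i ≠ k → i ≠ k + 1 → b' i = b i := fun i hi h1 h2 => by
    rw [h i hi, Equiv.swap_apply_of_ne_of_ne h1 h2]
  have himage_le : ∀ i ≤ k, b' '' Set.Iio i = b '' Set.Iio i := fun i hi =>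
    Set.image_congr fun j hj => by
      have : j < i := hj
      exact hother j (by omega) (by omega) (by omega)
  have himage_ge : ∀ i < n, k + 2 ≤ i → b' '' Set.Iio i = b '' Set.Iio i := fun i hi hki => by
    have hmaps : ∀ j < i, Equiv.swap k (k + 1) j < i := fun j hj => by
      rw [Equiv.swap_apply_def]
      split_ifs <;> omega
    ext x
    constructor
    · rintro ⟨j, hj, rfl⟩
      exact ⟨_, hmaps j hj, (h j (lt_trans hj hi)).symm⟩
    · rintro ⟨j, hj, rfl⟩
      refine ⟨_, hmaps j hj, ?_⟩
      rw [h _ ((hmaps j hj).trans hi), Equiv.swap_apply_self]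
  set v := gramSchmidt ℝ b k with hv
  set w := gramSchmidt ℝ b (k + 1) with hw
  set μ := inner ℝ v (b (k + 1)) / ‖v‖ ^ 2 with hμ
  have hvw : inner ℝ v w = 0 := gramSchmidt_orthogonal ℝ b (by omega)
  have hvb : ∀ j < k, inner ℝ v (b j) = 0 := fun j hj => gramSchmidt_inv_triangular ℝ b hj
  have hwb : ∀ j < k + 1, inner ℝ w (b j) = 0 := fun j hj => gramSchmidt_inv_triangular ℝ b hj
  have hwv : inner ℝ w v = 0 := by rw [real_inner_comm, hvw]
  have hub : w + μ • v - b (k + 1) ∈ Submodule.span ℝ (b '' Set.Iio k) := by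
    conv in b (k + 1) => rw [eq_gramSchmidt_add_sum b (k + 1)]
    rw [Finset.sum_range_succ, ← hv, ← hw, ← hμ, ← Submodule.neg_mem_iff]
    convert sum_smul_gramSchmidt_mem_span b
      (fun j => inner ℝ (gramSchmidt ℝ b j) (b (k + 1)) / ‖gramSchmidt ℝ b j‖ ^ 2) k using 1
    abel
  -- This is the component of `b (k + 1)` orthogonal to the vectors before `b k`.
  have hgk : gramSchmidt ℝ b' k = w + μ • v := by
    refine eq_gramSchmidt_of_orthogonal ?_ fun j hj => ?_
    · rwa [himage_le k le_rfl, hk']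
    · rw [hother j (by omega) (by omega) (by omega), inner_add_left, inner_smul_left, hvb j hj,
        hwb j (by omega), mul_zero, add_zero]
  have hnorm : ‖w + μ • v‖ ^ 2 = ‖w‖ ^ 2 + μ ^ 2 * ‖v‖ ^ 2 := by
    rw [norm_add_sq_real, inner_smul_right, hwv, norm_smul, mul_pow, Real.norm_eq_abs, sq_abs]
    ring
  have hwpos : 0 < ‖w‖ ^ 2 := pow_pos (norm_pos_iff.2 hne) 2
  have hupos : 0 < ‖w + μ • v‖ ^ 2 := by rw [hnorm]; positivity
  set u := w + μ • v with hu
  have huv : inner ℝ u v = μ * ‖v‖ ^ 2 := by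
    rw [hu, inner_add_left, hwv, inner_smul_left, real_inner_self_eq_norm_sq, zero_add]
    rfl
  have huu : inner ℝ u u = ‖u‖ ^ 2 := real_inner_self_eq_norm_sq u
  set c := μ * ‖v‖ ^ 2 / ‖u‖ ^ 2 with hc
  have hcu : c * ‖u‖ ^ 2 = μ * ‖v‖ ^ 2 := div_mul_cancel₀ _ hupos.ne'
  have hzu : inner ℝ (v - c • u) u = 0 := by
    rw [inner_sub_left, inner_smul_left, huu, real_inner_comm, huv]
    simp [hcu]
  have hzb : ∀ j < k, inner ℝ (v - c • u) (b j) = 0 := fun j hj => by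
    rw [inner_sub_left, inner_smul_left, hu, inner_add_left, inner_smul_left, hvb j hj,
      hwb j (by omega)]
    simp
  have hspan : Submodule.span ℝ (b '' Set.Iio k) ≤ Submodule.span ℝ (b' '' Set.Iio (k + 1)) := by
    rw [← himage_le k le_rfl]
    exact Submodule.span_mono (Set.image_mono (Set.Iio_subset_Iio (Nat.le_succ k)))
  -- The component of `v` orthogonal to the new vector `u`.
  have hgk1 : gramSchmidt ℝ b' (k + 1) = v - c • u := by
    refine eq_gramSchmidt_of_orthogonal ?_ fun j hj => ?_
    · have h1 := hspan (sub_gramSchmidt_mem_span b k)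
      have h2 := hspan hub
      have h3 : b (k + 1) ∈ Submodule.span ℝ (b' '' Set.Iio (k + 1)) :=
        Submodule.subset_span ⟨k, Nat.lt_succ_self k, hk'⟩
      have h4 := Submodule.smul_mem _ c (Submodule.add_mem _ h2 h3)
      rw [sub_add_cancel] at h4
      rw [hk1', ← Submodule.neg_mem_iff]
      convert Submodule.add_mem _ h1 h4 using 1
      abel
    · rcases Nat.lt_succ_iff_lt_or_eq.1 hj with hj | rfl
      · rw [hother j (by omega) (by omega) (by omega), hzb j hj]
      · have h0 : ∀ x ∈ Submodule.span ℝ (b '' Set.Iio j), inner ℝ (v - c • u) x = 0 := by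
          intro x hx
          induction hx using Submodule.span_induction with
          | mem x hx =>
            obtain ⟨l, hl, rfl⟩ := hx
            exact hzb l hl
          | zero => exact inner_zero_right _
          | add x y _ _ hx hy => rw [inner_add_right, hx, hy, add_zero]
          | smul a x _ hx => rw [inner_smul_right, hx, mul_zero]
        have := h0 _ hub
        rw [inner_sub_right, hzu, zero_sub, neg_eq_zero] at this
        rw [hk', this]
  refine ⟨fun i hi h1 h2 => ?_, ?_, ?_⟩
  · have himage : b' '' Set.Iio i = b '' Set.Iio i := by
      rcases lt_or_ge i (k + 1) with h3 | h3
      · exact himage_le i (by omega)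
      · exact himage_ge i hi (by omega)
    refine eq_gramSchmidt_of_orthogonal ?_ fun j hj => inner_gramSchmidt_of_mem_span ?_
    · rw [himage, hother i hi h1 h2, ← Submodule.neg_mem_iff, neg_sub]
      exact sub_gramSchmidt_mem_span b i
    · rw [← himage]
      exact Submodule.subset_span ⟨j, hj, rfl⟩
  · rw [hgk, hnorm]
  · rw [hgk, hgk1, norm_sub_sq_real, inner_smul_right, norm_smul, real_inner_comm, huv, mul_pow,
      Real.norm_eq_abs, sq_abs]
    -- The product is the squared area of the parallelogram on `v` and `u`, which is also that on
    -- `v` and `w`.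
    have h1 : c ^ 2 * ‖u‖ ^ 2 * ‖u‖ ^ 2 = (μ * ‖v‖ ^ 2) ^ 2 := by rw [← hcu]; ring
    have h2 : c * ‖u‖ ^ 2 * (μ * ‖v‖ ^ 2) = (μ * ‖v‖ ^ 2) ^ 2 := by rw [hcu]; ring
    linear_combination h1 - 2 * h2 + ‖v‖ ^ 2 * hnorm

/-- A lattice vector with a nonzero component along the last Gram–Schmidt vector is at least as
long as that vector. -/
lemma norm_gramSchmidt_le_of_inner_ne_zero {v : E}
    (hv : v ∈ Submodule.span ℤ (b '' Set.Iio (n + 1)))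
    (hne : inner ℝ (gramSchmidt ℝ b n) v ≠ 0) : ‖gramSchmidt ℝ b n‖ ≤ ‖v‖ := by
  -- Only the last basis vector contributes, and `z` is its integer coefficient; Cauchy–Schwarz with
  -- `|z| ≥ 1` then gives the bound.
  have hint : ∃ z : ℤ, inner ℝ (gramSchmidt ℝ b n) v = z * ‖gramSchmidt ℝ b n‖ ^ 2 := by
    clear hne
    induction hv using Submodule.span_induction with
    | mem x hx =>
      obtain ⟨j, hj, rfl⟩ := hx
      rcases Nat.lt_succ_iff_lt_or_eq.1 hj with hj | rfl
      · exact ⟨0, by rw [gramSchmidt_inv_triangular ℝ b hj]; simp⟩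
      · exact ⟨1, by rw [inner_gramSchmidt_self]; simp⟩
    | zero => exact ⟨0, by simp⟩
    | add x y _ _ hx hy =>
      obtain ⟨p, hp⟩ := hx
      obtain ⟨q, hq⟩ := hy
      exact ⟨p + q, by rw [inner_add_right, hp, hq]; push_cast; ring⟩
    | smul a x _ hx =>
      obtain ⟨p, hp⟩ := hx
      exact ⟨a * p, by rw [← Int.cast_smul_eq_zsmul ℝ, inner_smul_right, hp]; push_cast; ring⟩
  obtain ⟨z, hz⟩ := hint
  have hz0 : z ≠ 0 := by
    rintro rfl
    exact hne (by rw [hz]; simp)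
  have hpos : 0 < ‖gramSchmidt ℝ b n‖ := norm_pos_iff.2 fun h0 => hne (by rw [h0, inner_zero_left])
  have h1 := abs_real_inner_le_norm (gramSchmidt ℝ b n) v
  rw [hz, abs_mul, abs_of_nonneg (sq_nonneg ‖_‖)] at h1
  have h2 : (1 : ℝ) ≤ |(z : ℝ)| := by exact_mod_cast Int.one_le_abs hz0
  refine le_of_mul_le_mul_left ?_ hpos
  nlinarith [sq_nonneg ‖gramSchmidt ℝ b n‖]

lemma span_eq_top_of_gramSchmidt_ne_zero [FiniteDimensional ℝ E] (hn : Module.finrank ℝ E = n)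
    (hne : ∀ i < n, gramSchmidt ℝ b i ≠ 0) : Submodule.span ℝ (b '' Set.Iio n) = ⊤ := by
  have hli : LinearIndependent ℝ fun i : Fin n => gramSchmidt ℝ b i :=
    linearIndependent_of_ne_zero_of_inner_eq_zero (fun i => hne i i.2) fun i j hij =>
      gramSchmidt_orthogonal ℝ b fun h => hij (Fin.ext h)
  rw [← span_gramSchmidt_Iio, ← hli.span_eq_top_of_card_eq_finrank' (by simp [hn])]
  congr 1
  ext x
  exact ⟨fun ⟨i, hi, hx⟩ => ⟨⟨i, hi⟩, hx⟩, fun ⟨i, hx⟩ => ⟨i, i.2, hx⟩⟩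

/-- The hypothesis gives a factor `√2` per index; 2 avoids square roots. -/
lemma norm_gramSchmidt_le_of_reduced
    (hred : ∀ k, k + 1 < n + 1 → ‖gramSchmidt ℝ b k‖ ^ 2 ≤ 2 * ‖gramSchmidt ℝ b (k + 1)‖ ^ 2)
    (hi : i ≤ n) : ‖gramSchmidt ℝ b i‖ ≤ 2 ^ (n - i) * ‖gramSchmidt ℝ b n‖ := by
  induction hi using Nat.decreasingInduction with
  | self => simp
  | of_succ k hk ih =>
    have h1 : ‖gramSchmidt ℝ b k‖ ≤ 2 * ‖gramSchmidt ℝ b (k + 1)‖ := by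
      refine le_of_sq_le_sq ?_ (by positivity)
      nlinarith [hred k (by omega), sq_nonneg ‖gramSchmidt ℝ b (k + 1)‖]
    rw [show n - k = n - (k + 1) + 1 by omega, pow_succ]
    linarith

end GramSchmidt

/-! ### Changes of lattice basis and the potential -/

lemma span_int_image_eq {E : Type*} [AddCommGroup E] {b b' : ℕ → E} {n : ℕ}
    (h : ∀ i < n, b' i - b i ∈ Submodule.span ℤ (b '' Set.Iio i)) :
    Submodule.span ℤ (b' '' Set.Iio n) = Submodule.span ℤ (b '' Set.Iio n) := by
  have hmono : ∀ (c : ℕ → E) (i : ℕ), i ≤ n → Submodule.span ℤ (c '' Set.Iio i) ≤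
      Submodule.span ℤ (c '' Set.Iio n) := fun c i hi =>
    Submodule.span_mono (Set.image_mono (Set.Iio_subset_Iio hi))
  apply le_antisymm
  · rw [Submodule.span_le]
    rintro _ ⟨i, hi, rfl⟩
    have := Submodule.add_mem _ (hmono b i (le_of_lt hi) (h i hi))
      (Submodule.subset_span ⟨i, hi, rfl⟩)
    rwa [sub_add_cancel] at this
  · rw [Submodule.span_le]
    rintro _ ⟨i, hi, rfl⟩
    induction i using Nat.strong_induction_on with
    | _ i ih =>
      have hle : Submodule.span ℤ (b '' Set.Iio i) ≤ Submodule.span ℤ (b' '' Set.Iio n) := by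
        rw [Submodule.span_le]
        rintro _ ⟨j, hj, rfl⟩
        exact ih j hj (lt_trans (Set.mem_Iio.1 hj) hi)
      have hi' : b' i ∈ Submodule.span ℤ (b' '' Set.Iio n) := Submodule.subset_span ⟨i, hi, rfl⟩
      have := Submodule.sub_mem _ hi' (hle (h i hi))
      rwa [sub_sub_cancel] at this

lemma image_swap_Iio {E : Type*} {b b' : ℕ → E} {k n : ℕ} (hkn : k + 1 < n)
    (h : ∀ i < n, b' i = b (Equiv.swap k (k + 1) i)) :
    b' '' Set.Iio n = b '' Set.Iio n := by
  have hmaps : ∀ j < n, Equiv.swap k (k + 1) j < n := fun j hj => by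
    rw [Equiv.swap_apply_def]
    split_ifs <;> omega
  ext x
  constructor
  · rintro ⟨j, hj, rfl⟩
    exact ⟨_, hmaps j hj, (h j hj).symm⟩
  · rintro ⟨j, hj, rfl⟩
    refine ⟨_, hmaps j hj, ?_⟩
    rw [h _ (hmaps j hj), Equiv.swap_apply_self]

/-- The potential that decreases in lattice basis reduction. -/
def latticePotential (n : ℕ) (a : ℕ → ℝ) : ℝ :=
  ∏ j ∈ Finset.range n, ∏ i ∈ Finset.range (j + 1), a i

/-- Of the partial products that make up the potential, only the one ending at `k` changes: shorter
ones contain neither `a k` nor `a (k + 1)`, longer ones contain both. -/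
lemma latticePotential_le {n k : ℕ} {a a' : ℕ → ℝ} (ha : ∀ i < n, 0 < a i)
    (hkn : k + 1 < n)
    (heq : ∀ i < n, i ≠ k → i ≠ k + 1 → a' i = a i)
    (hmul : a' k * a' (k + 1) = a k * a (k + 1)) {c : ℝ} (hk : a' k ≤ c * a k) :
    latticePotential n a' ≤ c * latticePotential n a := by
  have hlt : ∀ j < k, ∏ i ∈ Finset.range (j + 1), a' i = ∏ i ∈ Finset.range (j + 1), a i := by
    intro j hj
    refine Finset.prod_congr rfl fun i hi => ?_
    have := Finset.mem_range.1 hi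
    exact heq i (by omega) (by omega) (by omega)
  have hk0 : ∏ i ∈ Finset.range k, a' i = ∏ i ∈ Finset.range k, a i := by
    refine Finset.prod_congr rfl fun i hi => ?_
    have := Finset.mem_range.1 hi
    exact heq i (by omega) (by omega) (by omega)
  have hgt : ∀ j, k + 1 ≤ j → j < n →
      ∏ i ∈ Finset.range (j + 1), a' i = ∏ i ∈ Finset.range (j + 1), a i := by
    intro j hj
    induction j, hj using Nat.le_induction with
    | base =>
      intro _
      rw [Finset.prod_range_succ, Finset.prod_range_succ, Finset.prod_range_succ _ (k + 1),
        Finset.prod_range_succ _ k, mul_assoc, mul_assoc, hmul, hk0]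
    | succ j hj ih =>
      intro hjn
      rw [Finset.prod_range_succ, ih (by omega), heq _ hjn (by omega) (by omega),
        ← Finset.prod_range_succ]
  have hpos : ∀ j < n, 0 < ∏ i ∈ Finset.range (j + 1), a i := fun j hj =>
    Finset.prod_pos fun i hi => ha i (by have := Finset.mem_range.1 hi; omega)
  have hkmem : k ∈ Finset.range n := Finset.mem_range.2 (by omega)
  rw [latticePotential, latticePotential, ← Finset.mul_prod_erase _ _ hkmem,
    ← Finset.mul_prod_erase _ _ hkmem, ← mul_assoc]
  rw [Finset.prod_congr (s₁ := (Finset.range n).erase k) rfl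
    (g := fun j => ∏ i ∈ Finset.range (j + 1), a i)]
  · refine mul_le_mul_of_nonneg_right ?_ (Finset.prod_nonneg fun j hj =>
      (hpos j (Finset.mem_range.1 (Finset.mem_of_mem_erase hj))).le)
    rw [Finset.prod_range_succ, Finset.prod_range_succ, hk0]
    have := Finset.prod_pos (s := Finset.range k) (f := a) fun i hi =>
      ha i (by have := Finset.mem_range.1 hi; omega)
    nlinarith
  · intro j hj
    obtain ⟨hjk, hj⟩ := Finset.mem_erase.1 hj
    rcases lt_or_gt_of_ne hjk with h | h
    · exact hlt j h
    · exact hgt j h (Finset.mem_range.1 hj)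

/-! ### Reduction of integer bases -/

/-- An integer vector as a point of Euclidean space. -/
def intVec {n : ℕ} (v : Fin n → ℤ) : EuclideanSpace ℝ (Fin n) := WithLp.toLp 2 fun i => (v i : ℝ)

section IntegerRows

variable {n : ℕ}

@[simp] lemma intVec_apply (v : Fin n → ℤ) (i : Fin n) : intVec v i = v i := rfl

lemma intVec_sub_smul (v w : Fin n → ℤ) (z : ℤ) :
    intVec (v - z • w) = intVec v - z • intVec w := by
  ext i
  simp

/-- The Gram–Schmidt vectors of a sequence of integer vectors. -/
noncomputable def orthRow (b : ℕ → Fin n → ℤ) (i : ℕ) : EuclideanSpace ℝ (Fin n) :=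
  gramSchmidt ℝ (fun i => intVec (b i)) i

lemma gramSchmidt_intVec (b : ℕ → Fin n → ℤ) (i : ℕ) :
    gramSchmidt ℝ (fun i => intVec (b i)) i = orthRow b i := rfl

/-- Size reduction of `v` against the first `i` vectors of `b`. -/
noncomputable def reduceRow (b : ℕ → Fin n → ℤ) : ℕ → (Fin n → ℤ) → Fin n → ℤ
  | 0, v => v
  | i + 1, v => reduceRow b i
      (v - round (inner ℝ (orthRow b i) (intVec v) / ‖orthRow b i‖ ^ 2) • b i)

lemma reduceRow_sub_mem (b : ℕ → Fin n → ℤ) (i : ℕ) (v : Fin n → ℤ) :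
    intVec (reduceRow b i v) - intVec v ∈
      Submodule.span ℤ ((fun i => intVec (b i)) '' Set.Iio i) := by
  induction i generalizing v with
  | zero => simp [reduceRow]
  | succ i ih =>
    rw [reduceRow]
    set z := round (inner ℝ (orthRow b i) (intVec v) / ‖orthRow b i‖ ^ 2)
    have h1 := Submodule.span_mono (R := ℤ)
      (Set.image_mono (f := fun i => intVec (b i)) (Set.Iio_subset_Iio (Nat.le_succ i)))
      (ih (v - z • b i))
    have h2 : z • intVec (b i) ∈
        Submodule.span ℤ ((fun i => intVec (b i)) '' Set.Iio (i + 1)) :=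
      Submodule.smul_mem _ z (Submodule.subset_span ⟨i, Nat.lt_succ_self i, rfl⟩)
    convert Submodule.sub_mem _ h1 h2 using 1
    rw [intVec_sub_smul]
    abel

lemma reduceRow_sub_mem_real (b : ℕ → Fin n → ℤ) (i : ℕ) (v : Fin n → ℤ) :
    intVec (reduceRow b i v) - intVec v ∈
      Submodule.span ℝ ((fun i => intVec (b i)) '' Set.Iio i) :=
  Submodule.span_subset_span ℤ ℝ _ (reduceRow_sub_mem b i v)

/-- Later rows are subtracted first. The rows before `b j` are orthogonal to `orthRow b j`, so
subtracting them afterwards does not disturb the coefficient already rounded. -/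
lemma abs_inner_orthRow_reduceRow_le (b : ℕ → Fin n → ℤ) {i j : ℕ} (hj : j < i)
    (v : Fin n → ℤ) :
    |inner ℝ (orthRow b j) (intVec (reduceRow b i v))| ≤ ‖orthRow b j‖ ^ 2 / 2 := by
  induction i generalizing v with
  | zero => exact absurd hj (Nat.not_lt_zero j)
  | succ i ih =>
    rw [reduceRow]
    rcases Nat.lt_succ_iff_lt_or_eq.1 hj with hj | rfl
    · exact ih hj _
    · set q := inner ℝ (orthRow b j) (intVec v) / ‖orthRow b j‖ ^ 2 with hq
      have h := inner_gramSchmidt_of_mem_span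
        (reduceRow_sub_mem_real b j (v - round q • b j))
      rw [inner_sub_right, sub_eq_zero] at h
      change inner ℝ (orthRow b j) _ = inner ℝ (orthRow b j) _ at h
      have hself : inner ℝ (orthRow b j) (intVec (b j)) = ‖orthRow b j‖ ^ 2 :=
        inner_gramSchmidt_self (fun i => intVec (b i)) j
      rcases eq_or_ne (orthRow b j) 0 with h0 | h0
      · rw [h0]
        simp
      have hpos : 0 < ‖orthRow b j‖ ^ 2 := pow_pos (norm_pos_iff.2 h0) 2
      have hval : inner ℝ (orthRow b j) (intVec v) = q * ‖orthRow b j‖ ^ 2 := by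
        rw [hq, div_mul_cancel₀ _ hpos.ne']
      rw [h, intVec_sub_smul, inner_sub_right, ← Int.cast_smul_eq_zsmul ℝ, inner_smul_right,
        hself, hval, ← sub_mul, abs_mul, abs_of_pos hpos]
      nlinarith [abs_sub_round q]

lemma norm_gramSchmidt_le {E : Type*} [NormedAddCommGroup E] [InnerProductSpace ℝ E] (b : ℕ → E)
    (i : ℕ) : ‖gramSchmidt ℝ b i‖ ≤ ‖b i‖ := by
  rcases (norm_nonneg (gramSchmidt ℝ b i)).eq_or_lt with h | h
  · rw [← h]
    exact norm_nonneg _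
  · refine le_of_mul_le_mul_left ?_ h
    rw [← sq, ← inner_gramSchmidt_self]
    exact real_inner_le_norm _ _

/-- The integer vectors `b 0, …, b (n - 1)` are a basis of `L`, with bounds in terms of `ρ`. -/
structure IsBoundedBasis (L : Submodule ℤ (EuclideanSpace ℝ (Fin n))) (ρ : ℝ)
    (b : ℕ → Fin n → ℤ) : Prop where
  ne_zero : ∀ i < n, orthRow b i ≠ 0
  span_eq : Submodule.span ℤ ((fun i => intVec (b i)) '' Set.Iio n) = L
  norm_orthRow_le : ∀ i < n, ‖orthRow b i‖ ≤ ρ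
  norm_le : ∀ i < n, ‖intVec (b i)‖ ≤ n * ρ

/-- The potential of a basis. -/
noncomputable def rowPotential (b : ℕ → Fin n → ℤ) : ℝ :=
  latticePotential n fun i => ‖orthRow b i‖ ^ 2

lemma IsBoundedBasis.rowPotential_pos {L : Submodule ℤ (EuclideanSpace ℝ (Fin n))} {ρ : ℝ}
    {b : ℕ → Fin n → ℤ} (hb : IsBoundedBasis L ρ b) : 0 < rowPotential b := by
  rw [rowPotential, latticePotential]
  exact Finset.prod_pos fun j hj => Finset.prod_pos fun i hi => pow_pos (norm_pos_iff.2
    (hb.ne_zero i (by have := Finset.mem_range.1 hi; have := Finset.mem_range.1 hj; omega))) 2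

/-- All rows of `b`, reduced. -/
noncomputable def reduceAll (b : ℕ → Fin n → ℤ) (i : ℕ) : Fin n → ℤ := reduceRow b i (b i)

/-- Each row is reduced against the original rows, not the reduced ones; the change is
unitriangular, so both have the same Gram–Schmidt vectors. -/
lemma orthRow_reduceAll (b : ℕ → Fin n → ℤ) (i : ℕ) : orthRow (reduceAll b) i = orthRow b i :=
  gramSchmidt_eq_of_sub_mem_span (n := i + 1) (fun i _ => reduceRow_sub_mem_real b i (b i)) i
    (Nat.lt_succ_self i)

lemma span_reduceAll (b : ℕ → Fin n → ℤ) :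
    Submodule.span ℤ ((fun i => intVec (reduceAll b i)) '' Set.Iio n) =
      Submodule.span ℤ ((fun i => intVec (b i)) '' Set.Iio n) :=
  span_int_image_eq fun i _ => reduceRow_sub_mem b i (b i)

lemma norm_reduceAll_le (b : ℕ → Fin n → ℤ) {i : ℕ} (hi : i < n) {ρ : ℝ}
    (hρ : ∀ i < n, ‖orthRow b i‖ ≤ ρ) : ‖intVec (reduceAll b i)‖ ≤ n * ρ := by
  refine (norm_le_sum_norm_gramSchmidt (b := fun i => intVec (b i))
    (b' := fun i => intVec (reduceAll b i)) (n := n)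
    (fun i _ => reduceRow_sub_mem_real b i (b i))
    (fun i _ j hj => abs_inner_orthRow_reduceRow_le b hj (b i)) hi).trans ?_
  have hρ0 : 0 ≤ ρ := (norm_nonneg _).trans (hρ i hi)
  refine (Finset.sum_le_card_nsmul _ _ ρ fun j hj =>
    hρ j (by have := Finset.mem_range.1 hj; omega)).trans ?_
  rw [Finset.card_range, nsmul_eq_mul]
  exact mul_le_mul_of_nonneg_right (by exact_mod_cast hi) hρ0

/-- Size reduction followed by an exchange. -/
lemma IsBoundedBasis.swap {L : Submodule ℤ (EuclideanSpace ℝ (Fin n))} {ρ : ℝ}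
    {b b' : ℕ → Fin n → ℤ} (hb : IsBoundedBasis L ρ b) {k : ℕ} (hkn : k + 1 < n)
    (hk : 2 * ‖orthRow b (k + 1)‖ ^ 2 < ‖orthRow b k‖ ^ 2)
    (h : ∀ i < n, b' i = reduceAll b (Equiv.swap k (k + 1) i)) :
    IsBoundedBasis L ρ b' ∧ rowPotential b' ≤ 3 / 4 * rowPotential b := by
  have hmaps : ∀ j < n, Equiv.swap k (k + 1) j < n := fun j hj => by
    rw [Equiv.swap_apply_def]
    split_ifs <;> omega
  obtain ⟨h1, h2, h3⟩ := gramSchmidt_swap (b := fun i => intVec (reduceAll b i))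
    (b' := fun i => intVec (b' i)) hkn
    (by rw [← orthRow, orthRow_reduceAll]; exact hb.ne_zero _ hkn) fun i hi => by
      simp only [h i hi]
  simp only [gramSchmidt_intVec, orthRow_reduceAll] at h1 h2 h3
  have hpos : ∀ i < n, 0 < ‖orthRow b i‖ ^ 2 := fun i hi =>
    pow_pos (norm_pos_iff.2 (hb.ne_zero i hi)) 2
  have hp := hpos k (by omega)
  have hp1 := hpos (k + 1) hkn
  set q := inner ℝ (orthRow b k) (intVec (reduceAll b (k + 1))) / ‖orthRow b k‖ ^ 2 with hq
  have hq2 : q ^ 2 ≤ 1 / 4 := by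
    have : |q| ≤ 1 / 2 := by
      rw [hq, abs_div, abs_of_pos hp, div_le_iff₀ hp]
      have := abs_inner_orthRow_reduceRow_le b (Nat.lt_succ_self k) (b (k + 1))
      rw [reduceAll]
      linarith
    rw [← sq_abs]
    nlinarith [abs_nonneg q]
  -- The exchange condition contributes 1/2 and the size-reduced coefficient 1/4.
  have hk34 : ‖orthRow b' k‖ ^ 2 ≤ 3 / 4 * ‖orthRow b k‖ ^ 2 := by
    rw [h2]
    nlinarith
  have hk'ge : ‖orthRow b (k + 1)‖ ^ 2 ≤ ‖orthRow b' k‖ ^ 2 := by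
    rw [h2]
    nlinarith [sq_nonneg q]
  have hk'pos : 0 < ‖orthRow b' k‖ ^ 2 := hp1.trans_le hk'ge
  -- The product of the two squared norms is preserved and `hk'ge` bounds the first new one below,
  -- so the bound `ρ` survives the exchange.
  have hk1' : ‖orthRow b' (k + 1)‖ ^ 2 ≤ ‖orthRow b k‖ ^ 2 := by
    refine le_of_mul_le_mul_left ?_ hk'pos
    rw [h3, mul_comm]
    exact mul_le_mul_of_nonneg_right hk'ge hp.le
  have hk1'pos : 0 < ‖orthRow b' (k + 1)‖ ^ 2 := by
    refine pos_of_mul_pos_right ?_ hk'pos.le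
    rw [h3]
    positivity
  refine ⟨⟨fun i hi => ?_, ?_, fun i hi => ?_, fun i hi => ?_⟩, ?_⟩
  · rcases eq_or_ne i k with rfl | hik
    · exact fun h0 => hk'pos.ne' (by rw [h0]; simp)
    rcases eq_or_ne i (k + 1) with rfl | hik1
    · exact fun h0 => hk1'pos.ne' (by rw [h0]; simp)
    rw [h1 i hi hik hik1]
    exact hb.ne_zero i hi
  · rw [image_swap_Iio (b := fun i => intVec (reduceAll b i)) hkn fun i hi => by simp only [h i hi], span_reduceAll,
      hb.span_eq]
  · rcases eq_or_ne i k with rfl | hik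
    · exact (le_of_sq_le_sq (by linarith) (norm_nonneg _)).trans (hb.norm_orthRow_le i hi)
    rcases eq_or_ne i (k + 1) with rfl | hik1
    · exact (le_of_sq_le_sq hk1' (norm_nonneg _)).trans (hb.norm_orthRow_le k (by omega))
    rw [h1 i hi hik hik1]
    exact hb.norm_orthRow_le i hi
  · rw [h i hi]
    exact norm_reduceAll_le b (hmaps i hi) hb.norm_orthRow_le
  · exact latticePotential_le hpos hkn (fun i hi hik hik1 => by rw [h1 i hi hik hik1]) h3 hk34

/-- In a reduced basis every vector outside the hyperplane orthogonal to the last Gram–Schmidt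
vector is, up to a constant, as long as a set of vectors that span the space. -/
lemma IsBoundedBasis.exists_spanning_set {d : ℕ}
    {L : Submodule ℤ (EuclideanSpace ℝ (Fin (d + 1)))} {ρ : ℝ} {b : ℕ → Fin (d + 1) → ℤ}
    (hb : IsBoundedBasis L ρ b)
    (hred : ∀ k < d, ‖orthRow b k‖ ^ 2 ≤ 2 * ‖orthRow b (k + 1)‖ ^ 2)
    {v : EuclideanSpace ℝ (Fin (d + 1))} (hv : v ∈ L) (hne : inner ℝ (orthRow b d) v ≠ 0) :
    ∃ S ⊆ (L : Set (EuclideanSpace ℝ (Fin (d + 1)))), Submodule.span ℝ S = ⊤ ∧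
      ∀ w ∈ S, ‖w‖ ≤ (d + 1 : ℕ) * 2 ^ (d + 1) * ‖v‖ := by
  have hlast : ‖orthRow b d‖ ≤ ‖v‖ :=
    norm_gramSchmidt_le_of_inner_ne_zero (by rw [hb.span_eq]; exact hv) hne
  have hle : ∀ i < d + 1, ‖orthRow b i‖ ≤ 2 ^ (d + 1) * ‖v‖ := fun i hi => by
    refine (norm_gramSchmidt_le_of_reduced (fun k hk => hred k (by omega))
      (Nat.lt_succ_iff.1 hi)).trans ?_
    exact mul_le_mul (pow_le_pow_right₀ one_le_two (by omega)) hlast (norm_nonneg _) (by positivity)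
  -- The basis `b` itself need not be size reduced.
  refine ⟨(fun i => intVec (reduceAll b i)) '' Set.Iio (d + 1), ?_, ?_, ?_⟩
  · rw [← hb.span_eq, ← span_reduceAll]
    exact Submodule.subset_span
  · refine span_eq_top_of_gramSchmidt_ne_zero (finrank_euclideanSpace_fin ..) fun i hi => ?_
    rw [← orthRow, orthRow_reduceAll]
    exact hb.ne_zero i hi
  · rintro _ ⟨i, hi, rfl⟩
    rw [mul_assoc]
    exact norm_reduceAll_le b hi hle

end IntegerRows

/-! ### Programs for one reduction step and for the normal vector -/

namespace BitRAM

/-- The `i`-th row of the matrix with `n` columns that is stored row by row. -/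
def memRow (n : ℕ) (m : Mem) (i : ℕ) : Fin n → ℤ := fun j => m (n * i + j)

section Step

variable {n k : ℕ}

lemma mul_add_lt_mul {i : ℕ} (hi : i < n) (j : Fin n) : n * i + j < n * n := by
  have := j.2
  nlinarith

lemma StraightLineFrac.inner {u v : Mem → EuclideanSpace ℝ (Fin n)}
    (hu : ∀ j, StraightLineFrac k fun m => u m j) (hv : ∀ j, StraightLineFrac k fun m => v m j) :
    StraightLineFrac k fun m => inner ℝ (u m) (v m) := by
  simp only [PiLp.inner_apply]
  exact StraightLineFrac.sum _ fun j _ => (hv j).mul (hu j)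

lemma StraightLineFrac.norm_sq {u : Mem → EuclideanSpace ℝ (Fin n)}
    (hu : ∀ j, StraightLineFrac k fun m => u m j) :
    StraightLineFrac k fun m => ‖u m‖ ^ 2 := by
  simp only [← real_inner_self_eq_norm_sq]
  exact StraightLineFrac.inner hu hu

lemma straightLine_memRow {i : ℕ} (hi : i < n) (j : Fin n) :
    StraightLine (n * n) fun m => memRow n m i j :=
  .var (mul_add_lt_mul hi j)

/-- For fixed `n` the Gram–Schmidt recursion unrolls into finitely many field operations on the
matrix entries. -/
lemma straightLineFrac_orthRow {i : ℕ} (hi : i < n) (j : Fin n) :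
    StraightLineFrac (n * n) fun m => orthRow (memRow n m) i j := by
  induction i using Nat.strong_induction_on generalizing j with
  | _ i ih =>
    have key : ∀ m, orthRow (memRow n m) i j = (memRow n m i j : ℝ) - ∑ l ∈ Finset.range i,
        inner ℝ (orthRow (memRow n m) l) (intVec (memRow n m i)) / ‖orthRow (memRow n m) l‖ ^ 2 *
          orthRow (memRow n m) l j := fun m => by
      have := congrArg (fun v : EuclideanSpace ℝ (Fin n) => v j)
        (eq_gramSchmidt_add_sum (fun i => intVec (memRow n m i)) i)
      simp only [gramSchmidt_intVec, PiLp.add_apply, WithLp.ofLp_sum, Finset.sum_apply,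
        PiLp.smul_apply, smul_eq_mul, intVec_apply] at this
      linarith
    simp only [key]
    refine (straightLine_memRow hi j).frac.sub (StraightLineFrac.sum _ fun l hl => ?_)
    have hl' := Finset.mem_range.1 hl
    have hl := ih l hl' (hl'.trans hi)
    exact ((StraightLineFrac.inner hl fun j => (straightLine_memRow hi j).frac).div
      (.norm_sq hl)).mul (hl j)

lemma straightLine_reduceRow {i : ℕ} (hi : i ≤ n) {v : Mem → Fin n → ℤ}
    (hv : ∀ j, StraightLine (n * n) fun m => v m j) (j : Fin n) :
    StraightLine (n * n) fun m => reduceRow (memRow n m) i (v m) j := by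
  induction i generalizing v with
  | zero => exact hv j
  | succ i ih =>
    simp only [reduceRow]
    refine ih (Nat.le_of_succ_le hi) fun j => ?_
    have ho := straightLineFrac_orthRow (i := i) hi
    simp only [Pi.sub_apply, Pi.smul_apply, smul_eq_mul]
    exact (hv j).sub ((((StraightLineFrac.inner ho fun j => (hv j).frac).div
      (.norm_sq ho)).straightLine_round).mul (straightLine_memRow hi j))

/-- Positive when the rows `k` and `k + 1` have to be exchanged. -/
noncomputable def swapGap (n : ℕ) (m : Mem) (k : ℕ) : ℝ :=
  ‖orthRow (memRow n m) k‖ ^ 2 - 2 * ‖orthRow (memRow n m) (k + 1)‖ ^ 2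

/-- The rows after one step of the reduction, which exchanges the rows `l` and `l + 1` for the
largest possible `l < k`. -/
noncomputable def nextRow (n : ℕ) (m : Mem) : ℕ → ℕ → Fin n → ℤ
  | 0, i, j => memRow n m i j
  | k + 1, i, j =>
      if 0 < swapGap n m k then reduceAll (memRow n m) (Equiv.swap k (k + 1) i) j
      else nextRow n m k i j

/-- Whether one step of the reduction exchanges two rows. -/
noncomputable def nextFlag (n : ℕ) (m : Mem) : ℕ → ℤ
  | 0 => 0
  | k + 1 => if 0 < swapGap n m k then 1 else nextFlag n m k

lemma nextRow_spec (n : ℕ) (m : Mem) (k : ℕ) :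
    (∃ l < k, 0 < swapGap n m l ∧ nextFlag n m k = 1 ∧
      ∀ i, nextRow n m k i = reduceAll (memRow n m) (Equiv.swap l (l + 1) i)) ∨
    ((∀ l < k, swapGap n m l ≤ 0) ∧ nextFlag n m k = 0 ∧
      ∀ i, nextRow n m k i = memRow n m i) := by
  induction k with
  | zero => exact .inr ⟨fun l hl => absurd hl (Nat.not_lt_zero l), rfl, fun i => rfl⟩
  | succ k ih =>
    by_cases hk : 0 < swapGap n m k
    · refine .inl ⟨k, Nat.lt_succ_self k, hk, if_pos hk, fun i => funext fun j => ?_⟩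
      rw [nextRow, if_pos hk]
    · have hrow : ∀ i, nextRow n m (k + 1) i = nextRow n m k i := fun i => funext fun j => by
        rw [nextRow, if_neg hk]
      have hflag : nextFlag n m (k + 1) = nextFlag n m k := if_neg hk
      simp only [hrow, hflag]
      rcases ih with ⟨l, hl, h⟩ | ⟨hl, h⟩
      · exact .inl ⟨l, hl.trans (Nat.lt_succ_self k), h⟩
      · refine .inr ⟨fun l hlk => ?_, h⟩
        rcases Nat.lt_succ_iff_lt_or_eq.1 hlk with h' | rfl
        · exact hl l h'
        · exact not_lt.1 hk

lemma straightLineFrac_swapGap {l : ℕ} (hl : l + 1 < n) :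
    StraightLineFrac (n * n) fun m => swapGap n m l :=
  (StraightLineFrac.norm_sq (straightLineFrac_orthRow (Nat.lt_of_succ_lt hl))).sub
    ((by simpa using (StraightLine.const (n * n) 2).frac :
      StraightLineFrac (n * n) fun _ => (2 : ℝ)).mul
        (.norm_sq (straightLineFrac_orthRow hl)))

lemma straightLine_nextRow (hk : k < n) {i : ℕ} (hi : i < n) (j : Fin n) :
    StraightLine (n * n) fun m => nextRow n m k i j := by
  induction k with
  | zero => exact straightLine_memRow hi j
  | succ k ih =>
    simp only [nextRow]
    have hmap : Equiv.swap k (k + 1) i < n := by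
      rw [Equiv.swap_apply_def]
      split_ifs <;> omega
    exact (straightLineFrac_swapGap hk).straightLine_ite
      (straightLine_reduceRow hmap.le (straightLine_memRow hmap) j) (ih (by omega))

lemma straightLine_nextFlag (hk : k < n) : StraightLine (n * n) fun m => nextFlag n m k := by
  induction k with
  | zero => exact .const _ 0
  | succ k ih =>
    simp only [nextFlag]
    exact (straightLineFrac_swapGap hk).straightLine_ite (.const _ 1) (ih (by omega))

/-- Through `pos_bounds` this bounds the potential above and below, with no appeal to the
integrality of Gram determinants. -/
lemma straightLineFrac_rowPotential :
    StraightLineFrac (n * n) fun m => rowPotential (memRow n m) := by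
  simp only [rowPotential, latticePotential]
  exact StraightLineFrac.prod _ fun j hj => StraightLineFrac.prod _ fun i hi =>
    .norm_sq (straightLineFrac_orthRow
      (by have := Finset.mem_range.1 hi; have := Finset.mem_range.1 hj; omega))

/-- A program for one step of the reduction. Register `n * n` records whether rows were
exchanged. -/
lemma exists_prog_step (d : ℕ) : ∃ (P : Prog) (K : ℕ), ∀ (m : Mem) (β : ℕ), 1 ≤ β →
    (∀ r < (d + 1) * (d + 1), bitLen (m r) ≤ β) →
    ∃ t m', Exec P m t m' ∧ t ≤ K * β ^ 2 ∧
      (∀ i < d + 1, memRow (d + 1) m' i = nextRow (d + 1) m d i) ∧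
      m' ((d + 1) * (d + 1)) = nextFlag (d + 1) m d := by
  have hd : 0 < d + 1 := Nat.succ_pos d
  -- Quotient and remainder of `r` by `d + 1` are the row and column of an entry; the one further
  -- register holds the flag.
  obtain ⟨P, K, hP⟩ := exists_prog_assign ((d + 1) * (d + 1)) ((d + 1) * (d + 1) + 1)
    (fun r m => if r < (d + 1) * (d + 1) then
      nextRow (d + 1) m d (r / (d + 1)) ⟨r % (d + 1), Nat.mod_lt r hd⟩ else nextFlag (d + 1) m d)
    (fun r _ => by
      by_cases hr : r < (d + 1) * (d + 1)
      · simp only [if_pos hr]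
        exact straightLine_nextRow (Nat.lt_succ_self d) (Nat.div_lt_of_lt_mul hr) _
      · simp only [if_neg hr]
        exact straightLine_nextFlag (Nat.lt_succ_self d))
  refine ⟨P, K, fun m β hβ hm => ?_⟩
  obtain ⟨t, m', hE, ht, hval⟩ := hP m β hβ hm
  refine ⟨t, m', hE, ht, fun i hi => funext fun j => ?_, ?_⟩
  · have hlt := mul_add_lt_mul hi j
    rw [memRow, (hval _ (by omega)).1, if_pos hlt]
    congr 1
    · rw [Nat.mul_add_div hd, Nat.div_eq_of_lt j.2, add_zero]
    · exact Fin.ext (by simp [Nat.mod_eq_of_lt j.2])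
  · rw [(hval _ (Nat.lt_succ_self _)).1, if_neg (lt_irrefl _)]

/-- A program that computes an integer normal vector of the hyperplane orthogonal to the last
Gram–Schmidt vector. -/
lemma exists_prog_normal (d : ℕ) : ∃ (P : Prog) (K : ℕ), ∀ (m : Mem) (β : ℕ), 1 ≤ β →
    (∀ r < (d + 1) * (d + 1), bitLen (m r) ≤ β) →
    ∃ t m', Exec P m t m' ∧ t ≤ K * β ^ 2 ∧ ∃ c : ℝ, c ≠ 0 ∧
      intVec (outputVec (d + 1) m') = c • orthRow (memRow (d + 1) m) d := by
  choose a e ha he he0 hae using fun j => straightLineFrac_orthRow (Nat.lt_add_one d) j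
  have hd : 0 < d + 1 := Nat.succ_pos d
  -- The vector is multiplied by the product of all its denominators; the remainder modulo `d + 1`
  -- only serves to make an index of type `Fin`.
  obtain ⟨P, K, hP⟩ := exists_prog_assign ((d + 1) * (d + 1)) (d + 1)
    (fun r m => a ⟨r % (d + 1), Nat.mod_lt r hd⟩ m *
      ∏ l ∈ Finset.univ.erase ⟨r % (d + 1), Nat.mod_lt r hd⟩, e l m)
    (fun r _ => (ha _).mul (StraightLine.prod _ fun l _ => he l))
  refine ⟨P, K, fun m β hβ hm => ?_⟩
  obtain ⟨t, m', hE, ht, hval⟩ := hP m β hβ hm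
  have hpos : ∀ l, (0 : ℝ) < e l m := fun l => Int.cast_pos.2 (he0 l m)
  refine ⟨t, m', hE, ht, ∏ l, (e l m : ℝ), Finset.prod_ne_zero_iff.2 fun l _ => (hpos l).ne', ?_⟩
  ext j
  have hae' : orthRow (memRow (d + 1) m) d j = a j m / e j m := hae j m
  have hj : (⟨j % (d + 1), Nat.mod_lt _ hd⟩ : Fin (d + 1)) = j :=
    Fin.ext (Nat.mod_eq_of_lt j.2)
  rw [intVec_apply, outputVec, (hval j j.2).1, hj, PiLp.smul_apply, hae', smul_eq_mul,
    ← Finset.mul_prod_erase _ _ (Finset.mem_univ j)]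
  push_cast
  field_simp [(hpos j).ne']

end Step

end BitRAM

/-! ### The reduction loop -/

lemma norm_intVec_le {n : ℕ} {v : Fin n → ℤ} {M : ℝ} (hM : 0 ≤ M) (hv : ∀ j, |(v j : ℝ)| ≤ M) :
    ‖intVec v‖ ≤ n * M := by
  refine le_of_sq_le_sq ?_ (by positivity)
  rw [EuclideanSpace.real_norm_sq_eq]
  refine (Finset.sum_le_card_nsmul _ _ (M ^ 2) fun j _ => ?_).trans ?_
  · rw [intVec_apply, ← sq_abs]
    exact pow_le_pow_left₀ (abs_nonneg _) (hv j) 2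
  · rw [Finset.card_univ, Fintype.card_fin, nsmul_eq_mul, mul_pow]
    refine mul_le_mul_of_nonneg_right ?_ (sq_nonneg M)
    exact_mod_cast Nat.le_self_pow two_ne_zero n

namespace BitRAM

lemma abs_cast_le_two_pow_bitLen (a : ℤ) : |(a : ℝ)| ≤ 2 ^ bitLen a := by
  rw [← Int.cast_abs, Int.abs_eq_natAbs, Int.cast_natCast]
  exact_mod_cast (natAbs_lt_two_pow_bitLen a).le

lemma bitLen_le_of_abs_lt {a : ℤ} {β : ℕ} (h : |(a : ℝ)| < 2 ^ β) : bitLen a ≤ β + 1 := by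
  rw [bitLen_le_succ_iff]
  rw [← Int.cast_abs, Int.abs_eq_natAbs, Int.cast_natCast] at h
  exact_mod_cast h

lemma bitLen_le_of_norm_memRow {n : ℕ} {m : Mem} {β : ℕ}
    (h : ∀ i < n, ‖intVec (memRow n m i)‖ < 2 ^ β) :
    ∀ r < n * n, bitLen (m r) ≤ β + 1 := by
  intro r hr
  have hn : 0 < n := Nat.pos_of_mul_pos_right (r.zero_le.trans_lt hr)
  have hj := Nat.mod_lt r hn
  refine bitLen_le_of_abs_lt (lt_of_le_of_lt ?_ (h (r / n) (Nat.div_lt_of_lt_mul hr)))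
  have := PiLp.norm_apply_le (intVec (memRow n m (r / n))) ⟨r % n, hj⟩
  rwa [intVec_apply, memRow, Nat.div_add_mod, Real.norm_eq_abs] at this

/-- Iterating the reduction step gives a reduced basis, at polynomial cost. -/
lemma exists_prog_reduce (d : ℕ) : ∃ (P : Prog) (K : ℕ), ∀ (m : Mem) (β : ℕ) (ρ : ℝ)
    (L : Submodule ℤ (EuclideanSpace ℝ (Fin (d + 1)))),
    (d + 1 : ℕ) * ρ < 2 ^ β → IsBoundedBasis L ρ (memRow (d + 1) m) →
    m ((d + 1) * (d + 1)) = 1 →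
    ∃ t m', Exec P m t m' ∧ t ≤ K * (β + 1) ^ 3 ∧ IsBoundedBasis L ρ (memRow (d + 1) m') ∧
      ∀ k < d, swapGap (d + 1) m' k ≤ 0 := by
  obtain ⟨P, K, hP⟩ := exists_prog_step d
  obtain ⟨K', hK'⟩ := (straightLineFrac_rowPotential (n := d + 1)).pos_bounds
  refine ⟨.loop ((d + 1) * (d + 1)) P, (6 * K' + 2) * (4 + 2 * K),
    fun m β ρ L hβ hm hflag => ?_⟩
  have hbits : ∀ m', IsBoundedBasis L ρ (memRow (d + 1) m') →
      ∀ r < (d + 1) * (d + 1), bitLen (m' r) ≤ β + 1 := fun m' hm' =>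
    bitLen_le_of_norm_memRow fun i hi => (hm'.norm_le i hi).trans_lt hβ
  set c : ℝ := 2 ^ (K' * (β + 1)) with hc
  have hc0 : 0 < c := by positivity
  have hpot : ∀ m', IsBoundedBasis L ρ (memRow (d + 1) m') →
      rowPotential (memRow (d + 1) m') ≤ c ∧ 1 ≤ c * rowPotential (memRow (d + 1) m') :=
    fun m' hm' => hK' m' (β + 1) (Nat.succ_pos β) (hbits m' hm') hm'.rowPotential_pos
  obtain ⟨t, m', hE, ht, hfinal, N', hm', hN'⟩ := exec_loop
    (i := (d + 1) * (d + 1)) (P := P) (T := 2 + K * (β + 1) ^ 2)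
    -- While the flag is 1, `N` bounds the remaining iterations: the potential shrinks by 3/4 each
    -- time, and `N = 0` would contradict its lower bound `1 / c`.
    (fun N m => IsBoundedBasis L ρ (memRow (d + 1) m) ∧
      ((m ((d + 1) * (d + 1)) = 0 ∧ ∀ k < d, swapGap (d + 1) m k ≤ 0) ∨
        (m ((d + 1) * (d + 1)) = 1 ∧ c * rowPotential (memRow (d + 1) m) < (4 / 3) ^ N)))
    (fun N m hm => by
      have h2 : bitLen 0 ≤ 2 ∧ bitLen 1 ≤ 2 := by decide
      rcases hm.2 with h | h <;> rw [h.1] <;> omega)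
    (fun m hm => by
      rcases hm.2 with h | h
      · omega
      · have h1 := (hpot m hm.1).2
        have h2 := h.2
        rw [pow_zero] at h2
        exact absurd h1 (not_le.2 h2))
    (fun N m hm hpos => by
      have hlt : c * rowPotential (memRow (d + 1) m) < (4 / 3) ^ (N + 1) := by
        rcases hm.2 with h | h
        · omega
        · exact h.2
      obtain ⟨t, m', hE, ht, hrow, hfl⟩ := hP m (β + 1) (Nat.succ_pos β) (hbits m hm.1)
      refine ⟨t, m', hE, by omega, ?_⟩
      rcases nextRow_spec (d + 1) m d with ⟨l, hl, hgap, hone, hnext⟩ | ⟨hgap, hzero, hnext⟩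
      · obtain ⟨h1, h2⟩ := hm.1.swap (b' := memRow (d + 1) m') (k := l) (by omega) (sub_pos.1 hgap) fun i hi => by
          rw [hrow i hi, hnext]
        refine ⟨h1, .inr ⟨hfl.trans hone, ?_⟩⟩
        rw [pow_succ] at hlt
        nlinarith [mul_le_mul_of_nonneg_left h2 hc0.le]
      · have hsame : ∀ i < d + 1, memRow (d + 1) m' i = memRow (d + 1) m i := fun i hi => by
          rw [hrow i hi, hnext]
        have horth : ∀ i < d + 1, orthRow (memRow (d + 1) m') i = orthRow (memRow (d + 1) m) i :=
          gramSchmidt_eq_of_sub_mem_span fun i hi => by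
            simp only [hsame i hi, sub_self, Submodule.zero_mem]
        refine ⟨⟨fun i hi => ?_, ?_, fun i hi => ?_, fun i hi => ?_⟩,
          .inl ⟨hfl.trans hzero, fun k hk => ?_⟩⟩
        · rw [horth i hi]
          exact hm.1.ne_zero i hi
        · rw [← hm.1.span_eq]
          congr 1
          exact Set.image_congr fun i hi => by rw [hsame i hi]
        · rw [horth i hi]
          exact hm.1.norm_orthRow_le i hi
        · rw [hsame i hi]
          exact hm.1.norm_le i hi
        · rw [swapGap, horth k (by omega), horth (k + 1) (by omega)]
          exact hgap k hk)
    (6 * K' * (β + 1) + 1) m ⟨hm, .inr ⟨hflag, by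
      have h1 : c * rowPotential (memRow (d + 1) m) ≤ c * c :=
        mul_le_mul_of_nonneg_left (hpot m hm).1 hc0.le
      -- The exponent comes from `2 ≤ (4 / 3) ^ 3`; the extra iteration makes the inequality strict.
      have h2 : c * c ≤ (4 / 3) ^ (6 * K' * (β + 1)) := by
        rw [hc, ← pow_add, show 6 * K' * (β + 1) = 3 * (K' * (β + 1) + K' * (β + 1)) by ring,
          pow_mul]
        exact pow_le_pow_left₀ zero_le_two (by norm_num) _
      rw [pow_succ]
      have h3 : (0 : ℝ) < (4 / 3) ^ (6 * K' * (β + 1)) := by positivity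
      linarith⟩⟩
  refine ⟨t, m', hE, ht.trans ?_, hm', ?_⟩
  · have h1 : 1 ≤ β + 1 := Nat.succ_pos β
    generalize β + 1 = γ at h1 ⊢
    have h2 : 6 * K' * γ + 1 + 1 ≤ (6 * K' + 2) * γ := by nlinarith
    have h3 : 2 * (2 + K * γ ^ 2) ≤ (4 + 2 * K) * γ ^ 2 := by nlinarith
    exact (Nat.mul_le_mul h2 h3).trans (le_of_eq (by ring))
  · rcases hN' with h | h
    · exact h.2
    · exact absurd (h.1 ▸ one_pos) hfinal

/-! ### Reading the input and clearing denominators -/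

lemma inputMem_two_mul {n : ℕ} (B : Matrix (Fin n) (Fin n) ℚ) (q : Fin (n * n)) :
    inputMem B (2 * q) = (B (finProdFinEquiv.symm q).1 (finProdFinEquiv.symm q).2).num := by
  have h : 2 * (q : ℕ) / 2 = q := by omega
  simp [inputMem, h]

lemma inputMem_two_mul_add_one {n : ℕ} (B : Matrix (Fin n) (Fin n) ℚ) (q : Fin (n * n)) :
    inputMem B (2 * q + 1) =
      ((B (finProdFinEquiv.symm q).1 (finProdFinEquiv.symm q).2).den : ℤ) := by
  have h : (2 * (q : ℕ) + 1) / 2 = q := by omega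
  have h' : (2 * (q : ℕ) + 1) % 2 = 1 := by omega
  simp [inputMem, h, h']

lemma bitLen_inputMem_le {n : ℕ} (B : Matrix (Fin n) (Fin n) ℚ) :
    ∀ r < 2 * (n * n), bitLen (inputMem B r) ≤ inputSize B := by
  intro r hr
  have hsum : ∀ i j, bitLen (B i j).num + bitLen (B i j).den ≤ inputSize B := fun i j =>
    (Finset.single_le_sum (f := fun j => bitLen (B i j).num + bitLen (B i j).den)
      (fun _ _ => Nat.zero_le _) (Finset.mem_univ j)).trans
    (Finset.single_le_sum (f := fun i => ∑ j, (bitLen (B i j).num + bitLen (B i j).den))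
      (fun _ _ => Nat.zero_le _) (Finset.mem_univ i))
  obtain ⟨q, hq⟩ : ∃ q : Fin (n * n), r = 2 * q ∨ r = 2 * q + 1 :=
    ⟨⟨r / 2, by omega⟩, by simp only; omega⟩
  rcases hq with rfl | rfl
  · rw [inputMem_two_mul]
    exact (Nat.le_add_right _ _).trans (hsum _ _)
  · rw [inputMem_two_mul_add_one]
    exact (Nat.le_add_left _ _).trans (hsum _ _)

/-- A program that clears the denominators of the input. -/
lemma exists_prog_clear (n : ℕ) : ∃ (P : Prog) (K : ℕ), ∀ B : Matrix (Fin n) (Fin n) ℚ,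
    1 ≤ inputSize B → ∃ t m, Exec P (inputMem B) t m ∧ t ≤ K * inputSize B ^ 2 ∧
      m (n * n) = 1 ∧ (∀ r < n * n, bitLen (m r) ≤ K * inputSize B) ∧
      ∃ D : ℝ, 0 < D ∧ ∀ i : Fin n,
        intVec (memRow n m i) = D • WithLp.toLp 2 fun j => (B i j : ℝ) := by
  -- Each numerator is multiplied by the denominators of all other entries, which scales the matrix
  -- by their full product `D`. Register `n * n` is set to 1 so that the reduction loop starts.
  obtain ⟨P, K, hP⟩ := exists_prog_assign (2 * (n * n)) (n * n + 1)
    (fun r m => if h : r < n * n then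
      m (2 * r) * ∏ q ∈ Finset.univ.erase (⟨r, h⟩ : Fin (n * n)), m (2 * q + 1) else 1)
    (fun r _ => by
      by_cases h : r < n * n
      · simp only [dif_pos h]
        exact (StraightLine.var (by omega)).mul
          (StraightLine.prod _ fun q _ => .var (by have := q.2; omega))
      · simp only [dif_neg h]
        exact .const _ 1)
  refine ⟨P, K, fun B hB => ?_⟩
  obtain ⟨t, m, hE, ht, hval⟩ := hP (inputMem B) (inputSize B) hB (bitLen_inputMem_le B)
  refine ⟨t, m, hE, ht, ?_, fun r hr => (hval r (by omega)).2,
    ∏ q : Fin (n * n), (inputMem B (2 * q + 1) : ℝ), ?_, fun i => ?_⟩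
  · rw [(hval _ (Nat.lt_succ_self _)).1, dif_neg (lt_irrefl _)]
  · refine Finset.prod_pos fun q _ => ?_
    rw [inputMem_two_mul_add_one]
    exact_mod_cast Rat.den_pos _
  · ext j
    have hlt := mul_add_lt_mul i.2 j
    have hq : (⟨n * i + j, hlt⟩ : Fin (n * n)) = finProdFinEquiv (i, j) :=
      Fin.ext (by simp [add_comm])
    rw [intVec_apply, memRow, (hval _ (by omega)).1, dif_pos hlt, PiLp.smul_apply, smul_eq_mul,
      ← Finset.mul_prod_erase _ _ (Finset.mem_univ (⟨n * i + j, hlt⟩ : Fin (n * n)))]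
    have hnum := inputMem_two_mul B ⟨n * i + j, hlt⟩
    have hden := inputMem_two_mul_add_one B ⟨n * i + j, hlt⟩
    rw [hq, Equiv.symm_apply_apply, ← hq] at hnum hden
    simp only at hnum hden
    rw [hnum, hden, Int.cast_mul, Int.cast_prod]
    have h0 : ((B i j).den : ℝ) ≠ 0 := Nat.cast_ne_zero.2 (Rat.den_nz _)
    have h1 : (B i j : ℝ) = (B i j).num / (B i j).den := Rat.cast_def _
    simp only [h1, Int.cast_natCast]
    field_simp

end BitRAM

lemma linearIndependent_toLp_rows {n : ℕ} {B : Matrix (Fin n) (Fin n) ℚ} (hB : B.det ≠ 0) :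
    LinearIndependent ℝ fun i => (WithLp.toLp 2 fun j => (B i j : ℝ) :
      EuclideanSpace ℝ (Fin n)) := by
  have h1 : LinearIndependent ℝ (B.map ((↑) : ℚ → ℝ)).row := by
    rw [Matrix.linearIndependent_rows_iff_isUnit, Matrix.isUnit_iff_isUnit_det, isUnit_iff_ne_zero]
    have : (B.map ((↑) : ℚ → ℝ)).det = ((B.det : ℚ) : ℝ) := ((Rat.castHom ℝ).map_det B).symm
    rw [this]
    exact_mod_cast hB
  exact h1.map' (WithLp.linearEquiv 2 ℝ (Fin n → ℝ)).symm.toLinearMap (LinearEquiv.ker _)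

/-- The rows of a nonsingular matrix span a lattice. -/
lemma rowLattice_isZLattice {n : ℕ} (B : Matrix (Fin n) (Fin n) ℚ) (hB : B.det ≠ 0) :
    ∃ _ : DiscreteTopology (rowLattice B), IsZLattice ℝ (rowLattice B) := by
  have hlin := linearIndependent_toLp_rows hB
  have hspan := hlin.span_eq_top_of_card_eq_finrank' (by simp)
  let b := Module.Basis.mk hlin hspan.ge
  have : rowLattice B = Submodule.span ℤ (Set.range b) := by
    rw [Module.Basis.coe_mk, rowLattice]
  rw [this]
  exact ⟨inferInstance, inferInstance⟩

/-! ### The complete algorithm -/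

namespace BitRAM

/-- A program that computes a normal vector of a hyperplane such that any lattice vector outside the
hyperplane is, up to a constant, as long as a spanning set of lattice vectors. -/
lemma exists_prog_hyperplane (d : ℕ) : ∃ (P : Prog) (p : Polynomial ℕ),
    ∀ B : Matrix (Fin (d + 1)) (Fin (d + 1)) ℚ, B.det ≠ 0 →
      ∃ t m, Exec P (inputMem B) t m ∧ t ≤ p.eval (inputSize B) ∧
        intVec (outputVec (d + 1) m) ≠ 0 ∧
        ∀ v ∈ rowLattice B, inner ℝ (intVec (outputVec (d + 1) m)) v ≠ 0 →
          ∃ S ⊆ (rowLattice B : Set (EuclideanSpace ℝ (Fin (d + 1)))),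
            Submodule.span ℝ S = ⊤ ∧ ∀ w ∈ S, ‖w‖ ≤ (d + 1 : ℕ) * 2 ^ (d + 1) * ‖v‖ := by
  obtain ⟨P₁, K₁, hP₁⟩ := exists_prog_clear (d + 1)
  obtain ⟨P₂, K₂, hP₂⟩ := exists_prog_reduce d
  obtain ⟨P₃, K₃, hP₃⟩ := exists_prog_normal d
  set n := d + 1 with hn
  -- Chosen so that the bit bound `β + 1` used below is at most `M * s`.
  set M := n * n + K₁ + 1 with hM
  refine ⟨.seq P₁ (.seq P₂ P₃), .C K₁ * .X ^ 2 + .C (K₂ * M ^ 3) * .X ^ 3 +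
    .C (K₃ * M ^ 2) * .X ^ 2, fun B hB => ?_⟩
  set s := inputSize B with hs
  have hs1 : 1 ≤ s := (one_le_bitLen _).trans (bitLen_inputMem_le B 0 (by positivity))
  obtain ⟨t₁, m₁, hE₁, ht₁, hflag, hbits, D, hD, hrows⟩ := hP₁ B hs1
  set row : Fin n → EuclideanSpace ℝ (Fin n) := fun i => WithLp.toLp 2 fun j => (B i j : ℝ)
  have hlin : LinearIndependent ℝ row := linearIndependent_toLp_rows hB
  set ρ : ℝ := n * 2 ^ (K₁ * s) with hρ
  have hρ0 : 0 ≤ ρ := by positivity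
  have hrowle : ∀ i < n, ‖intVec (memRow n m₁ i)‖ ≤ ρ := fun i hi =>
    norm_intVec_le (by positivity) fun j => (abs_cast_le_two_pow_bitLen _).trans
      (pow_le_pow_right₀ one_le_two (hbits _ (mul_add_lt_mul hi j)))
  have hbasis : IsBoundedBasis (Submodule.span ℤ ((fun i => intVec (memRow n m₁ i)) '' Set.Iio n))
      ρ (memRow n m₁) := by
    refine ⟨fun i hi => ?_, rfl, fun i hi => (norm_gramSchmidt_le _ i).trans (hrowle i hi),
      fun i hi => (hrowle i hi).trans (le_mul_of_one_le_left hρ0 (by simp [hn]))⟩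
    refine gramSchmidt_ne_zero_coe i ?_
    have hinj : Function.Injective fun l : Set.Iic i => (⟨l, lt_of_le_of_lt l.2 hi⟩ : Fin n) :=
      fun a b hab => Subtype.ext (Fin.mk.inj hab)
    have := (hlin.comp _ hinj).map' (LinearEquiv.smulOfNeZero ℝ _ D hD.ne').toLinearMap
      (LinearEquiv.ker _)
    have heq : (fun i => intVec (memRow n m₁ i)) ∘ Subtype.val =
        fun l : Set.Iic i => D • row ⟨l, lt_of_le_of_lt l.2 hi⟩ :=
      funext fun l => hrows ⟨l, lt_of_le_of_lt l.2 hi⟩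
    rw [heq]
    exact this
  -- The factor `2 ^ (n * n)` absorbs the `n * n` in `n * ρ = n * n * 2 ^ (K₁ * s)`.
  set β := n * n + K₁ * s with hβ
  have hρβ : (n : ℝ) * ρ < 2 ^ β := by
    rw [hρ, hβ, pow_add, ← mul_assoc]
    refine mul_lt_mul_of_pos_right ?_ (by positivity)
    exact_mod_cast Nat.lt_two_pow_self
  have hβs : β + 1 ≤ M * s := by
    rw [hβ, hM]
    nlinarith
  obtain ⟨t₂, m₂, hE₂, ht₂, hm₂, hred⟩ := hP₂ m₁ β ρ _ hρβ hbasis hflag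
  obtain ⟨t₃, m₃, hE₃, ht₃, c, hc, hy⟩ := hP₃ m₂ (β + 1) (Nat.succ_pos β)
    (bitLen_le_of_norm_memRow fun i hi => (hm₂.norm_le i hi).trans_lt hρβ)
  refine ⟨_, m₃, .seq hE₁ (.seq hE₂ hE₃), ?_, ?_, fun v hv hne => ?_⟩
  · simp only [Polynomial.eval_add, Polynomial.eval_mul, Polynomial.eval_C, Polynomial.eval_pow,
      Polynomial.eval_X, mul_assoc, ← mul_pow]
    have h2 := ht₂.trans (Nat.mul_le_mul_left K₂ (Nat.pow_le_pow_left hβs 3))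
    have h3 := ht₃.trans (Nat.mul_le_mul_left K₃ (Nat.pow_le_pow_left hβs 2))
    rw [← hs] at ht₁
    omega
  · rw [hy]
    exact smul_ne_zero hc (hm₂.ne_zero d (Nat.lt_succ_self d))
  -- The reduction ran on `D` times the row lattice; scaling by `D` and `D⁻¹` passes between the two
  -- and preserves ratios of lengths.
  · have hto : ∀ w ∈ rowLattice B, D • w ∈
        Submodule.span ℤ ((fun i => intVec (memRow n m₁ i)) '' Set.Iio n) := by
      suffices h : rowLattice B ≤ (Submodule.span ℤ ((fun i => intVec (memRow n m₁ i)) ''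
          Set.Iio n)).comap (DistribSMul.toLinearMap ℤ _ D) from fun w hw => h hw
      rw [rowLattice, Submodule.span_le]
      rintro _ ⟨i, rfl⟩
      exact Submodule.subset_span ⟨i, i.2, hrows i⟩
    have hfrom : ∀ w ∈ Submodule.span ℤ ((fun i => intVec (memRow n m₁ i)) '' Set.Iio n),
        D⁻¹ • w ∈ rowLattice B := by
      suffices h : Submodule.span ℤ ((fun i => intVec (memRow n m₁ i)) '' Set.Iio n) ≤
          (rowLattice B).comap (DistribSMul.toLinearMap ℤ _ D⁻¹) from fun w hw => h hw
      rw [Submodule.span_le]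
      rintro _ ⟨i, hi, rfl⟩
      change D⁻¹ • intVec (memRow n m₁ i) ∈ rowLattice B
      have := hrows ⟨i, hi⟩
      simp only at this
      rw [this, inv_smul_smul₀ hD.ne']
      exact Submodule.subset_span ⟨⟨i, hi⟩, rfl⟩
    obtain ⟨S, hSL, hspan, hSv⟩ := hm₂.exists_spanning_set
      (fun k hk => sub_nonpos.1 (hred k hk)) (hto v hv) (by
        rw [hy, inner_smul_left] at hne
        rw [inner_smul_right]
        exact mul_ne_zero hD.ne' (right_ne_zero_of_mul hne))
    refine ⟨(fun w => D⁻¹ • w) '' S, ?_, ?_, ?_⟩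
    · rintro _ ⟨w, hw, rfl⟩
      exact hfrom w (hSL hw)
    · rw [Set.image_smul, Submodule.span_smul_eq_of_isUnit _ _ (inv_ne_zero hD.ne').isUnit, hspan]
    · rintro _ ⟨w, hw, rfl⟩
      have := hSv w hw
      rw [norm_smul, Real.norm_of_nonneg hD.le] at this
      rw [norm_smul, norm_inv, Real.norm_of_nonneg hD.le, inv_mul_le_iff₀ hD]
      linarith

end BitRAM

/-! ### The constant and the theorem -/

lemma finrank_normalSubspace {n : ℕ} {y : Fin n → ℤ} (hy : intVec y ≠ 0) :
    Module.finrank ℝ (normalSubspace y) + 1 = n := by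
  have := Submodule.finrank_add_finrank_orthogonal (Submodule.span ℝ {intVec y})
  rw [finrank_span_singleton hy, finrank_euclideanSpace_fin, add_comm] at this
  exact this

/-- The constant of the theorem. -/
def shortVectorConstant (n : ℕ) : ℕ := (2 * (1 + n * (n * 2 ^ n))) ^ n

lemma computable_shortVectorConstant : Computable shortVectorConstant := by
  have hpow : Primrec₂ ((· ^ ·) : ℕ → ℕ → ℕ) := Primrec₂.unpaired'.1 Nat.Primrec.pow
  have h2 : Primrec fun n : ℕ => n * 2 ^ n :=
    Primrec.nat_mul.comp .id (hpow.comp (.const 2) .id)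
  have h3 : Primrec fun n : ℕ => 2 * (1 + n * (n * 2 ^ n)) :=
    Primrec.nat_mul.comp (.const 2) (Primrec.nat_add.comp (.const 1) (Primrec.nat_mul.comp .id h2))
  exact (hpow.comp h3 .id).to_comp

/-- The constant is `(2 * (1 + n * C)) ^ n` with `C = n * 2 ^ n`, the factor lost by a reduced
basis. -/
lemma ncard_shortVectors_le_constant {n : ℕ} (hn : 0 < n)
    (Λ : Submodule ℤ (EuclideanSpace ℝ (Fin n))) [DiscreteTopology Λ] [IsZLattice ℝ Λ] {R : ℝ}
    (hR : 0 < R) {S : Set (EuclideanSpace ℝ (Fin n))} (hS : S ⊆ Λ)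
    (hspan : Submodule.span ℝ S = ⊤) (hSR : ∀ w ∈ S, ‖w‖ ≤ n * 2 ^ n * R) :
    ((shortVectors Λ R).ncard : ℝ) ≤
      (shortVectorConstant n : ℝ) * R ^ n / ZLattice.covolume Λ := by
  convert ncard_shortVectors_le Λ hR (C := n * 2 ^ n) (by positivity) hS hspan hSR using 4
  simp [shortVectorConstant]

theorem mainTheorem8 :
    ∃ A : ℕ → ℕ, Computable A ∧ ∀ n : ℕ, 0 < n →
      (∀ (Λ : Submodule ℤ (EuclideanSpace ℝ (Fin n))) [DiscreteTopology Λ] [IsZLattice ℝ Λ]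
          (R : ℝ), 0 < R →
        (A n : ℝ) * R ^ n / ZLattice.covolume Λ < ((shortVectors Λ R).ncard : ℝ) →
        ∃ H : Submodule ℝ (EuclideanSpace ℝ (Fin n)),
          Module.finrank ℝ H + 1 = n ∧ shortVectors Λ R ⊆ H) ∧
      ∃ (P : BitRAM.Prog) (p : Polynomial ℕ), ∀ B : Matrix (Fin n) (Fin n) ℚ, B.det ≠ 0 →
        ∃ (t : ℕ) (m : BitRAM.Mem),
          BitRAM.Exec P (BitRAM.inputMem B) t m ∧
          t ≤ p.eval (BitRAM.inputSize B) ∧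
          Module.finrank ℝ (normalSubspace (BitRAM.outputVec n m)) + 1 = n ∧
          ∀ R : ℝ, 0 < R →
            (A n : ℝ) * R ^ n / ZLattice.covolume (rowLattice B) <
              ((shortVectors (rowLattice B) R).ncard : ℝ) →
            shortVectors (rowLattice B) R ⊆ normalSubspace (BitRAM.outputVec n m) := by
  refine ⟨shortVectorConstant, computable_shortVectorConstant, fun n hn => ⟨?_, ?_⟩⟩
  · intro Λ _ _ R hR hlt
    -- If the short vectors spanned the space, they would themselves be the spanning set, since `1 ≤
    -- n * 2 ^ n`.
    refine exists_hyperplane_of_span_ne_top fun hspan => hlt.not_ge ?_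
    refine ncard_shortVectors_le_constant hn Λ hR (fun v hv => hv.1) hspan fun w hw => ?_
    refine hw.2.le.trans (le_mul_of_one_le_left hR.le ?_)
    have h1 : (1 : ℝ) ≤ n := by exact_mod_cast hn
    exact one_le_mul_of_one_le_of_one_le h1 (one_le_pow₀ one_le_two)
  · obtain ⟨d, rfl⟩ := Nat.exists_eq_succ_of_ne_zero hn.ne'
    obtain ⟨P, p, hP⟩ := BitRAM.exists_prog_hyperplane d
    refine ⟨P, p, fun B hB => ?_⟩
    obtain ⟨t, m, hE, ht, hy, hgood⟩ := hP B hB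
    refine ⟨t, m, hE, ht, finrank_normalSubspace hy, fun R hR hlt v hv => ?_⟩
    by_contra hvn
    have hne : inner ℝ (intVec (BitRAM.outputVec (d + 1) m)) v ≠ 0 := fun h =>
      hvn (Submodule.mem_orthogonal_singleton_iff_inner_right.2 h)
    -- As `‖v‖ < R`, these spanning vectors have length at most `n * 2 ^ n * R`, and the count
    -- applies.
    obtain ⟨S, hS, hspan, hSv⟩ := hgood v hv.1 hne
    obtain ⟨_, _⟩ := rowLattice_isZLattice B hB
    refine hlt.not_ge (ncard_shortVectors_le_constant hn _ hR hS hspan fun w hw => ?_)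
    exact (hSv w hw).trans (mul_le_mul_of_nonneg_left hv.2.le (by positivity))
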